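/- **Setting.** Fix $\tau\in(0,1)$ and integers $1\le k_1\le K_1$, $1\le k_2\le K_2$. For sample sizes $p_1,p_2,T$ let $$X_{ijt}=r_{0i}'F_{0t}c_{0j}+\varepsilon_{ijt},\qquad 1\le i\le p_1,\ 1\le j\le p_2,\ 1\le t\le T,$$ with non-random loadings $r_{0i}\in\mathbb R^{k_1}$, $c_{0j}\in\mathbb R^{k_2}$ and random factor matrices $F_{0t}\in\mathbb R^{k_1\times k_2}$; all of these objects (and the probability space) may depend on $(p_1,p_2,T)$. All limits are taken as $p_1,p_2,T\to\infty$. For all $\ell_1,\ell_2$ let $\mathcal A^{\ell_1}\subset\mathbb R^{\ell_1}$, $\mathcal B^{\ell_2}\subset\mathbb R^{\ell_2}$, $\mathcal F^{\ell_1\ell_2}\subset\mathbb R^{\ell_1\times\ell_2}$ be compact sets not depending on $(p_1,p_2,T)$, and let $\Theta^{\ell_1\ell_2}$ be the set of all $\theta=(R,F_1,\dots,F_T,C)$, where $R$ is $p_1\times\ell_1$ with rows $r_i'$, $C$ is $p_2\times\ell_2$ with rows $c_j'$, such that $r_i\in\mathcal A^{\ell_1}$, $c_j\in\mathcal B^{\ell_2}$,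 $F_t\in\mathcal F^{\ell_1\ell_2}$, $R'R/p_1=I$, $C'C/p_2=I$, and $\frac1T\sum_tF_tF_t'$ and $\frac1T\sum_tF_t'F_t$ are diagonal with non-increasing diagonal entries. **Assumptions.** For all large enough $p_1,p_2,T$: 1. Almost surely $\theta_0=(R_0,F_{01},\dots,F_{0T},C_0)\in\Theta^{k_1k_2}$; and for all $k_1\le\ell_1\le K_1$, $k_2\le\ell_2\le K_2$ almost surely some $\theta\in\Theta^{\ell_1\ell_2}$ has the true common components, $r_i'F_tc_j=r_{0i}'F_{0t}c_{0j}$ for all $i,j,t$ (for instance $\theta_0$ with added loading columns and with $F_{0t}$ padded by zeros). 2. Each diagonal entry of $\frac1T\sum_tF_{0t}F_{0t}'$ and of $\frac1T\sum_tF_{0t}'F_{0t}$ converges in probability to a positive constant. 3. Given $(F_{01},\dots,F_{0T})$, the errors $\varepsilon_{ijt}$ are independent over $i,j,t$, satisfy $P(\varepsilon_{ijt}\le0\mid F_{01},\dots,F_{0T})=\tau$ a.s., and have conditional densities $f_{ijt}$; for each compact $S\subset\mathbb R$ there is a constant $\underline f>0$, not depending on $p_1,p_2,T$, with $f_{ijt}\ge\underline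 f$ on $S$ for all $i,j,t$, a.s. **Estimators.** Let $\rho_\tau(u)=(\tau-1\{u\le0\})u$ and $$\mathbb M(\theta)=\frac1{p_1p_2T}\sum_{i,j,t}\rho_\tau(X_{ijt}-r_i'F_tc_j).$$ For $1\le\ell_1\le K_1$, $1\le\ell_2\le K_2$ and all large enough $p_1,p_2,T$, let $\hat\theta^{\ell_1\ell_2}$ be a minimizer of $\mathbb M$ over $\Theta^{\ell_1\ell_2}$. Let $L=\min\{\sqrt{p_1p_2},\sqrt{p_2T},\sqrt{p_1T}\}$, let $C_{p_1p_2T}$ be deterministic with $C_{p_1p_2T}\to0$ and $L^2C_{p_1p_2T}\to\infty$, and let $$(\hat k_1^{IC},\hat k_2^{IC})\in\arg\min_{1\le\ell_1\le K_1,\,1\le\ell_2\le K_2}\ \mathbb M(\hat\theta^{\ell_1\ell_2})+(\ell_1+\ell_2)\,C_{p_1p_2T}.$$ **Theorem 4.2.** (a) There is a constant $c>0$ such that for all $1\le\ell_1\le K_1$, $1\le\ell_2\le K_2$ with $\ell_1<k_1$ or $\ell_2<k_2$, $P\big(\mathbb M(\hat\theta^{\ell_1\ell_2})-\mathbb M(\hat\theta^{k_1k_2})>c\big)\to1$.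 (b) For all $k_1\le\ell_1\le K_1$, $k_2\le\ell_2\le K_2$: $\ \mathbb M(\hat\theta^{\ell_1\ell_2})-\mathbb M(\hat\theta^{k_1k_2})=O_p(L^{-2})$. (c) $P\big(\hat k_1^{IC}=k_1,\ \hat k_2^{IC}=k_2\big)\to1$. -/

import Mathlib

open Filter Topology MeasureTheory ProbabilityTheory

namespace MQF

/-- The check (quantile) loss `ρ_τ(u) = (τ - 1{u ≤ 0}) u`. -/
noncomputable def checkLoss (τ u : ℝ) : ℝ := (τ - if u ≤ 0 then 1 else 0) * u

/-- A parameter `θ = (R, F₁, …, F_T, C)` with row factor number `k₁` and column factor number `k₂`: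
the rows of `R` are the `r_i'`, the rows of `C` are the `c_j'`. -/
structure Params (k₁ k₂ p₁ p₂ T : ℕ) where
  R : Matrix (Fin p₁) (Fin k₁) ℝ
  F : Fin T → Matrix (Fin k₁) (Fin k₂) ℝ
  C : Matrix (Fin p₂) (Fin k₂) ℝ

/-- The common component `r_i' F_t c_j`, i.e. the `(i, j)` entry of `R F_t C'`. -/
def Params.common {k₁ k₂ p₁ p₂ T : ℕ} (θ : Params k₁ k₂ p₁ p₂ T)
    (i : Fin p₁) (j : Fin p₂) (t : Fin T) : ℝ :=
  (θ.R * θ.F t * θ.C.transpose) i j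

/-- The row second moment `T⁻¹ ∑_t F_t F_t'` of a sequence of factor matrices. -/
noncomputable def rowMoment {k₁ k₂ T : ℕ} (F : Fin T → Matrix (Fin k₁) (Fin k₂) ℝ) :
    Matrix (Fin k₁) (Fin k₁) ℝ :=
  (T : ℝ)⁻¹ • ∑ t, F t * (F t).transpose

/-- The column second moment `T⁻¹ ∑_t F_t' F_t` of a sequence of factor matrices. -/
noncomputable def colMoment {k₁ k₂ T : ℕ} (F : Fin T → Matrix (Fin k₁) (Fin k₂) ℝ) :
    Matrix (Fin k₂) (Fin k₂) ℝ :=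
  (T : ℝ)⁻¹ • ∑ t, (F t).transpose * F t

/-- Diagonal with non-increasing diagonal entries. -/
def IsDiagDescending {k : ℕ} (M : Matrix (Fin k) (Fin k) ℝ) : Prop :=
  M.IsDiag ∧ Antitone fun j => M j j

/-- The parameter space `Θ^{k₁k₂}`: `r_i ∈ A`, `c_j ∈ B`, `F_t ∈ 𝓕`, normalised by `R'R/p₁ = I`,
`C'C/p₂ = I`, and `T⁻¹ ∑ F_t F_t'`, `T⁻¹ ∑ F_t' F_t` diagonal with non-increasing entries. -/
def paramSpace {k₁ k₂ : ℕ} (A : Set (Fin k₁ → ℝ)) (B : Set (Fin k₂ → ℝ))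
    (𝓕 : Set (Matrix (Fin k₁) (Fin k₂) ℝ)) (p₁ p₂ T : ℕ) : Set (Params k₁ k₂ p₁ p₂ T) :=
  {θ | (∀ i, θ.R i ∈ A) ∧ (∀ t, θ.F t ∈ 𝓕) ∧ (∀ j, θ.C j ∈ B) ∧
    (p₁ : ℝ)⁻¹ • (θ.R.transpose * θ.R) = 1 ∧
    (p₂ : ℝ)⁻¹ • (θ.C.transpose * θ.C) = 1 ∧
    IsDiagDescending (rowMoment θ.F) ∧ IsDiagDescending (colMoment θ.F)}

/-- The average check loss
`𝕄(θ) = (p₁p₂T)⁻¹ ∑_{i,j,t} ρ_τ(X_{ijt} - r_i' F_t c_j)` of the data `X`. -/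
noncomputable def avgLoss {k₁ k₂ p₁ p₂ T : ℕ} (τ : ℝ) (X : Fin p₁ → Fin p₂ → Fin T → ℝ)
    (θ : Params k₁ k₂ p₁ p₂ T) : ℝ :=
  ((p₁ : ℝ) * p₂ * T)⁻¹ * ∑ i, ∑ j, ∑ t, checkLoss τ (X i j t - θ.common i j t)

/-- `θ` is a check-loss estimator over the parameter space `Θ`. -/
def IsEstimator {k₁ k₂ p₁ p₂ T : ℕ} (τ : ℝ) (X : Fin p₁ → Fin p₂ → Fin T → ℝ)
    (Θ : Set (Params k₁ k₂ p₁ p₂ T)) (θ : Params k₁ k₂ p₁ p₂ T) : Prop :=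
  θ ∈ Θ ∧ ∀ θ' ∈ Θ, avgLoss τ X θ ≤ avgLoss τ X θ'

/-- `k` minimises `V(ℓ₁, ℓ₂) + (ℓ₁ + ℓ₂) c` over `1 ≤ ℓ₁ ≤ K₁`, `1 ≤ ℓ₂ ≤ K₂`. -/
def IsICMinimizer (V : ℕ → ℕ → ℝ) (c : ℝ) (K₁ K₂ : ℕ) (k : ℕ × ℕ) : Prop :=
  k.1 ∈ Finset.Icc 1 K₁ ∧ k.2 ∈ Finset.Icc 1 K₂ ∧
    ∀ ℓ₁ ∈ Finset.Icc 1 K₁, ∀ ℓ₂ ∈ Finset.Icc 1 K₂,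
      V k.1 k.2 + ((k.1 : ℝ) + k.2) * c ≤ V ℓ₁ ℓ₂ + ((ℓ₁ : ℝ) + ℓ₂) * c

/-- The rate `L = min {√(p₁p₂), √(p₂T), √(p₁T)}`. -/
noncomputable def rate (p₁ p₂ T : ℕ) : ℝ :=
  min (Real.sqrt ((p₁ : ℝ) * p₂)) (min (Real.sqrt ((p₂ : ℝ) * T)) (Real.sqrt ((p₁ : ℝ) * T)))

/-- The Borel (product) `σ`-algebra on matrices, entry by entry. -/
instance {m n : Type*} : MeasurableSpace (Matrix m n ℝ) :=
  inferInstanceAs (MeasurableSpace (m → n → ℝ))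

/-- The `τ`-quantile matrix factor model at a given sample size. The errors `ε_{ijt}` are indexed
by triples `(i, j, t)`; `f` is their family of conditional densities, the first argument of
`f (i, j, t)` being the value of the whole factor sequence `(F₀₁, …, F₀T)`. The conditional law
of the error array given the factors is Mathlib's `condDistrib`. -/
structure IsQuantileModel {k₁ k₂ p₁ p₂ T : ℕ} {Ω : Type*} [MeasurableSpace Ω]
    (μ : Measure Ω) [IsProbabilityMeasure μ] (τ : ℝ)
    (F₀ : Ω → Fin T → Matrix (Fin k₁) (Fin k₂) ℝ)
    (ε : Ω → Fin p₁ × Fin p₂ × Fin T → ℝ)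
    (f : Fin p₁ × Fin p₂ × Fin T → (Fin T → Matrix (Fin k₁) (Fin k₂) ℝ) → ℝ → ℝ) : Prop where
  measurable_factor : Measurable F₀
  measurable_error : Measurable ε
  /-- Given the factors, the errors are independent across `i`, `j` and `t`. -/
  cond_indep : ∀ᵐ F ∂(μ.map F₀),
    iIndepFun (fun (x : Fin p₁ × Fin p₂ × Fin T) (e : Fin p₁ × Fin p₂ × Fin T → ℝ) => e x)
      (condDistrib ε F₀ μ F)
  /-- Given the factors, `ε_{ijt}` has density `f (i, j, t)`. -/
  cond_density : ∀ᵐ F ∂(μ.map F₀), ∀ x, Measurable (f x F) ∧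
    (condDistrib ε F₀ μ F).map (fun e => e x) =
      volume.withDensity fun u => ENNReal.ofReal (f x F u)
  /-- The quantile restriction `P(ε_{ijt} ≤ 0 | F₀) = τ`. -/
  cond_quantile : ∀ᵐ F ∂(μ.map F₀), ∀ x,
    condDistrib ε F₀ μ F {e | e x ≤ 0} = ENNReal.ofReal τ

/-- The event `E n` has probability tending to one, in the sense that the (outer) measure
of its complement tends to zero; for measurable events this is `P(E n) → 1`. -/
def HighProb {ι : Type*} (l : Filter ι) {Ω : ι → Type*} [∀ n, MeasurableSpace (Ω n)]
    (μ : ∀ n, Measure (Ω n)) (E : ∀ n, Set (Ω n)) : Prop :=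
  Tendsto (fun n => μ n (E n)ᶜ) l (𝓝 0)

/-- `Z n` converges to the constant `z` in probability. -/
def ConvergesInProb {ι : Type*} (l : Filter ι) {Ω : ι → Type*} [∀ n, MeasurableSpace (Ω n)]
    (μ : ∀ n, Measure (Ω n)) (Z : ∀ n, Ω n → ℝ) (z : ℝ) : Prop :=
  ∀ δ > 0, HighProb l μ fun n => {ω | |Z n ω - z| < δ}

/-- `Z n = O_p(a n)`. -/
def IsBigOInProb {ι : Type*} (l : Filter ι) {Ω : ι → Type*} [∀ n, MeasurableSpace (Ω n)]
    (μ : ∀ n, Measure (Ω n)) (Z : ∀ n, Ω n → ℝ) (a : ι → ℝ) : Prop :=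
  ∀ η : ENNReal, 0 < η → ∃ M : ℝ, ∀ᶠ n in l, μ n {ω | M * a n < |Z n ω|} ≤ η

end MQF

/-! Write S = p₁ + p₂ + T and N = p₁p₂T, and let d be the array of differences between the common
components of a candidate and the true ones. The loss difference is the excess loss of d divided by
N. The loading spaces have bounded dimension, so d is a sum of boundedly many rank-one arrays u ⊗ v
⊗ w (`commonDiff_mem_lowRank`).

The core is a lower bound valid for all such bounded d at once (`measureReal_compl_goodErrors_le`):
given the factors, outside an event of probability at most exp(-S), the excess is at least -K√S‖d‖,
and at least (3c/8)D² - K√S D when ‖d‖ = D. No chaining is needed. For a fixed array y,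
`exists_affine_minorant` puts below the random convex excess a random affine function of d with mean
(c/2)(‖d‖² - ‖d - y‖²). The noise in its slope is an array of independent bounded entries paired
with a low-rank array, hence O(√S)‖d‖ by a bound on the injective norm. Taking y = 0 gives the first
bound; letting y run through a net of exp(O(S)) points at scale D/2 gives the second.

Convexity along rays carries the quadratic bound beyond ‖d‖ = D. With D a multiple of √S, a d that
does not raise the loss has ‖d‖ ≤ D and lowers the total loss by O(S); since S/N = O(L⁻²), this
settles overfitting. With too few factors ‖d‖² ≥ N s (`le_norm_commonDiff_sq`), and D² = N s
dominates S, so the average loss rises by a constant. The penalty lies between these two orders,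
which gives consistency. -/

namespace MQF

/-! ### Nets of Euclidean balls -/

/-- The ball of radius two is covered by at most `5 ^ dim` unit balls. -/
lemma exists_net_ball_two (E : Type*) [NormedAddCommGroup E] [NormedSpace ℝ E]
    [FiniteDimensional ℝ E] :
    ∃ N : Finset E, N.card ≤ 5 ^ Module.finrank ℝ E ∧
      ∀ u : E, ‖u‖ ≤ 2 → ∃ u' ∈ N, ‖u - u'‖ ≤ 1 := by
  classical
  let P : ℕ → Prop := fun n => ∃ s : Finset E, s.card = n ∧ (∀ c ∈ s, ‖c‖ ≤ 2) ∧
    ∀ c ∈ s, ∀ d ∈ s, c ≠ d → 1 ≤ ‖c - d‖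
  have hb : ∀ n, P n → n ≤ 5 ^ Module.finrank ℝ E := by
    rintro n ⟨s, rfl, h1, h2⟩
    exact Besicovitch.card_le_of_separated s h1 h2
  have h0 : P 0 := ⟨∅, by simp⟩
  -- A 1-separated set of maximal cardinality is a net: a point at distance more than 1 from all of
  -- it could be added.
  obtain ⟨s, hs, h1, h2⟩ : P (Nat.findGreatest P (5 ^ Module.finrank ℝ E)) :=
    Nat.findGreatest_spec (Nat.zero_le _) h0
  refine ⟨s, hs ▸ hb _ ⟨s, hs, h1, h2⟩, fun u hu => ?_⟩
  by_contra! hcon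
  have hus : u ∉ s := fun h => by
    have := hcon u h
    simp at this
    linarith
  have hP : P (s.card + 1) := by
    refine ⟨insert u s, Finset.card_insert_of_notMem hus, ?_, ?_⟩
    · intro c hc
      rcases Finset.mem_insert.1 hc with rfl | hc
      exacts [hu, h1 c hc]
    · intro c hc d hd hcd
      rcases Finset.mem_insert.1 hc with hcu | hcs <;> rcases Finset.mem_insert.1 hd with hdu | hds
      · exact absurd (hcu.trans hdu.symm) hcd
      · exact hcu ▸ (hcon d hds).le
      · rw [norm_sub_rev]; exact hdu ▸ (hcon c hcs).le
      · exact h2 c hcs d hds hcd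
  have := Nat.le_findGreatest (hb _ hP) hP
  omega

/-- The unit ball is covered by at most `5 ^ (k dim)` balls of radius `2⁻ᵏ`. -/
lemma exists_net_unit_ball (E : Type*) [NormedAddCommGroup E] [NormedSpace ℝ E]
    [FiniteDimensional ℝ E] (k : ℕ) :
    ∃ N : Finset E, N.card ≤ (5 ^ k) ^ Module.finrank ℝ E ∧ (∀ u' ∈ N, ‖u'‖ ≤ 2) ∧
      ∀ u : E, ‖u‖ ≤ 1 → ∃ u' ∈ N, ‖u - u'‖ ≤ (1 / 2) ^ k := by
  classical
  obtain ⟨N₁, hN₁, hcov₁⟩ := exists_net_ball_two E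
  suffices h : ∃ N : Finset E, N.card ≤ (5 ^ k) ^ Module.finrank ℝ E ∧
      ∀ u : E, ‖u‖ ≤ 1 → ∃ u' ∈ N, ‖u - u'‖ ≤ (1 / 2) ^ k by
    obtain ⟨N, hN, hcov⟩ := h
    -- Net points of norm above 2 can be dropped, being at distance more than 1 from the unit ball.
    refine ⟨N.filter fun u => ‖u‖ ≤ 2, (Finset.card_filter_le _ _).trans hN, by simp, fun u hu => ?_⟩
    obtain ⟨u', hu', h⟩ := hcov u hu
    refine ⟨u', Finset.mem_filter.2 ⟨hu', ?_⟩, h⟩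
    have h1 : (1 / 2 : ℝ) ^ k ≤ 1 := pow_le_one₀ (by norm_num) (by norm_num)
    have h2 := norm_sub_norm_le u' u
    rw [norm_sub_rev] at h2
    linarith
  induction k with
  | zero => exact ⟨{0}, by simp, fun u hu => ⟨0, by simp, by simpa using hu⟩⟩
  | succ k ih =>
    obtain ⟨N, hN, hcov⟩ := ih
    -- Each ball of radius 2⁻ᵏ, blown up by 2ᵏ⁺¹, has radius 2 and is covered by unit balls.
    refine ⟨Finset.image₂ (fun a b => a + (1 / 2 : ℝ) ^ (k + 1) • b) N N₁, ?_, fun u hu => ?_⟩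
    · calc _ ≤ N.card * N₁.card := Finset.card_image₂_le _ _ _
        _ ≤ (5 ^ k) ^ Module.finrank ℝ E * 5 ^ Module.finrank ℝ E := Nat.mul_le_mul hN hN₁
        _ = _ := by rw [← mul_pow, pow_succ]
    · obtain ⟨a, ha, hua⟩ := hcov u hu
      obtain ⟨b, hb, hub⟩ := hcov₁ ((2 : ℝ) ^ (k + 1) • (u - a)) (by
        rw [norm_smul, Real.norm_of_nonneg (by positivity)]
        calc (2 : ℝ) ^ (k + 1) * ‖u - a‖ ≤ 2 ^ (k + 1) * (1 / 2) ^ k := by gcongr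
          _ = 2 := by rw [pow_succ, mul_right_comm, ← mul_pow]; norm_num)
      refine ⟨_, Finset.mem_image₂_of_mem ha hb, ?_⟩
      have h2 : (1 / 2 : ℝ) ^ (k + 1) * 2 ^ (k + 1) = 1 := by rw [← mul_pow]; norm_num
      have : u - (a + (1 / 2 : ℝ) ^ (k + 1) • b) =
          (1 / 2 : ℝ) ^ (k + 1) • ((2 : ℝ) ^ (k + 1) • (u - a) - b) := by
        rw [smul_sub, smul_smul, h2, one_smul]; abel
      rw [this, norm_smul, Real.norm_of_nonneg (by positivity)]
      exact mul_le_of_le_one_right (by positivity) hub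

/-- Every vector is its norm times a vector of norm at most one. -/
lemma exists_eq_norm_smul {E : Type*} [NormedAddCommGroup E] [NormedSpace ℝ E] (z : E) :
    ∃ z' : E, ‖z'‖ ≤ 1 ∧ z = ‖z‖ • z' := by
  rcases eq_or_ne z 0 with rfl | hz
  · exact ⟨0, by simp⟩
  · have : ‖z‖ ≠ 0 := norm_ne_zero_iff.2 hz
    exact ⟨‖z‖⁻¹ • z, by rw [norm_smul, norm_inv, norm_norm, inv_mul_cancel₀ this],
      by rw [smul_smul, mul_inv_cancel₀ this, one_smul]⟩

/-! ### Rank-one arrays and the injective norm -/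

section Tensors

variable {α β γ : Type*}

/-- The rank-one array `u ⊗ v ⊗ w`. -/
noncomputable def outer (u : EuclideanSpace ℝ α) (v : EuclideanSpace ℝ β)
    (w : EuclideanSpace ℝ γ) : EuclideanSpace ℝ (α × β × γ) :=
  WithLp.toLp 2 fun x => u x.1 * v x.2.1 * w x.2.2

@[simp] lemma outer_apply (u : EuclideanSpace ℝ α) (v : EuclideanSpace ℝ β)
    (w : EuclideanSpace ℝ γ) (x : α × β × γ) : outer u v w x = u x.1 * v x.2.1 * w x.2.2 := rfl

lemma norm_outer [Fintype α] [Fintype β] [Fintype γ]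
    (u : EuclideanSpace ℝ α) (v : EuclideanSpace ℝ β) (w : EuclideanSpace ℝ γ) :
    ‖outer u v w‖ = ‖u‖ * ‖v‖ * ‖w‖ := by
  have h : ‖outer u v w‖ ^ 2 = (‖u‖ * ‖v‖ * ‖w‖) ^ 2 := by
    rw [mul_pow, mul_pow]
    simp only [EuclideanSpace.real_norm_sq_eq, outer_apply, mul_pow]
    rw [Fintype.sum_prod_type, mul_assoc, Finset.sum_mul_sum, Finset.sum_mul]
    refine Finset.sum_congr rfl fun a _ => ?_
    rw [Fintype.sum_prod_type, Finset.mul_sum]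
    refine Finset.sum_congr rfl fun b _ => ?_
    simp only [Finset.mul_sum]
    exact Finset.sum_congr rfl fun c _ => by ring
  exact (pow_left_inj₀ (by positivity) (by positivity) two_ne_zero).1 h

lemma outer_sub_outer (u u' : EuclideanSpace ℝ α) (v v' : EuclideanSpace ℝ β)
    (w w' : EuclideanSpace ℝ γ) :
    outer u v w - outer u' v' w' =
      outer (u - u') v w + outer u' (v - v') w + outer u' v' (w - w') := by
  ext x; simp; ring

lemma outer_smul_right (u : EuclideanSpace ℝ α) (v : EuclideanSpace ℝ β)
    (w : EuclideanSpace ℝ γ) (s : ℝ) : outer u v (s • w) = s • outer u v w := by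
  ext x; simp; ring

lemma outer_smul_smul_smul (u : EuclideanSpace ℝ α) (v : EuclideanSpace ℝ β)
    (w : EuclideanSpace ℝ γ) (r s t : ℝ) :
    outer (r • u) (s • v) (t • w) = (r * s * t) • outer u v w := by
  ext x; simp; ring

lemma continuous_outer : Continuous fun q : EuclideanSpace ℝ α × EuclideanSpace ℝ β ×
    EuclideanSpace ℝ γ => outer q.1 q.2.1 q.2.2 := by
  refine (PiLp.continuous_toLp 2 _).comp (continuous_pi fun x => ?_)
  fun_prop

/-- A linear form that is at most `t` on the rank-one arrays built from nets of the unit balls is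
at most `2 t` on all rank-one arrays of unit vectors. -/
lemma inner_outer_le_of_net [Fintype α] [Fintype β] [Fintype γ]
    {N₁ : Finset (EuclideanSpace ℝ α)} {N₂ : Finset (EuclideanSpace ℝ β)}
    {N₃ : Finset (EuclideanSpace ℝ γ)}
    (h₁ : ∀ u : EuclideanSpace ℝ α, ‖u‖ ≤ 1 → ∃ u' ∈ N₁, ‖u - u'‖ ≤ (1 / 2) ^ 4)
    (h₂ : ∀ u : EuclideanSpace ℝ β, ‖u‖ ≤ 1 → ∃ u' ∈ N₂, ‖u - u'‖ ≤ (1 / 2) ^ 4)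
    (h₃ : ∀ u : EuclideanSpace ℝ γ, ‖u‖ ≤ 1 → ∃ u' ∈ N₃, ‖u - u'‖ ≤ (1 / 2) ^ 4)
    (hb₁ : ∀ u ∈ N₁, ‖u‖ ≤ 2) (hb₂ : ∀ u ∈ N₂, ‖u‖ ≤ 2)
    (ξ : EuclideanSpace ℝ (α × β × γ)) {t : ℝ} (ht : 0 ≤ t)
    (h : ∀ u ∈ N₁, ∀ v ∈ N₂, ∀ w ∈ N₃, inner ℝ ξ (outer u v w) ≤ t)
    (u : EuclideanSpace ℝ α) (v : EuclideanSpace ℝ β) (w : EuclideanSpace ℝ γ) :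
    inner ℝ ξ (outer u v w) ≤ 2 * t * (‖u‖ * ‖v‖ * ‖w‖) := by
  let B : Set (EuclideanSpace ℝ α × EuclideanSpace ℝ β × EuclideanSpace ℝ γ) :=
    Metric.closedBall 0 1 ×ˢ (Metric.closedBall 0 1 ×ˢ Metric.closedBall 0 1)
  have hB : IsCompact B := (isCompact_closedBall _ _).prod
    ((isCompact_closedBall _ _).prod (isCompact_closedBall _ _))
  have hBmem : ∀ q, q ∈ B ↔ ‖q.1‖ ≤ 1 ∧ ‖q.2.1‖ ≤ 1 ∧ ‖q.2.2‖ ≤ 1 := by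
    intro q; simp [B, Set.mem_prod]
  -- By compactness the supremum m over the product of unit balls is attained; `hom` extends it by
  -- homogeneity.
  obtain ⟨q, hq, hmax⟩ := hB.exists_isMaxOn ⟨0, by simp [hBmem]⟩
    (f := fun q => inner ℝ ξ (outer q.1 q.2.1 q.2.2))
    ((continuous_const.inner continuous_outer).continuousOn)
  set m := inner ℝ ξ (outer q.1 q.2.1 q.2.2) with hm
  have hmax' : ∀ a b c, ‖a‖ ≤ 1 → ‖b‖ ≤ 1 → ‖c‖ ≤ 1 → inner ℝ ξ (outer a b c) ≤ m :=
    fun a b c ha hb hc => hmax (a := (a, b, c)) ((hBmem _).2 ⟨ha, hb, hc⟩)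
  have hm0 : 0 ≤ m := by
    have := hmax' 0 0 0 (by simp) (by simp) (by simp)
    have h0 : outer (0 : EuclideanSpace ℝ α) (0 : EuclideanSpace ℝ β) (0 : EuclideanSpace ℝ γ) = 0 := by
      ext x; simp
    simpa [h0] using this
  have hom : ∀ a b c, inner ℝ ξ (outer a b c) ≤ m * (‖a‖ * ‖b‖ * ‖c‖) := by
    intro a b c
    obtain ⟨a', ha', ha⟩ := exists_eq_norm_smul a
    obtain ⟨b', hb', hb⟩ := exists_eq_norm_smul b
    obtain ⟨c', hc', hc⟩ := exists_eq_norm_smul c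
    calc inner ℝ ξ (outer a b c) = inner ℝ ξ (outer (‖a‖ • a') (‖b‖ • b') (‖c‖ • c')) := by
          rw [← ha, ← hb, ← hc]
      _ = ‖a‖ * ‖b‖ * ‖c‖ * inner ℝ ξ (outer a' b' c') := by
          rw [outer_smul_smul_smul, inner_smul_right]
      _ ≤ ‖a‖ * ‖b‖ * ‖c‖ * m :=
          mul_le_mul_of_nonneg_left (hmax' _ _ _ ha' hb' hc') (by positivity)
      _ = _ := mul_comm _ _
  have hq' := (hBmem q).1 hq
  obtain ⟨u', hu', hdu⟩ := h₁ q.1 hq'.1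
  obtain ⟨v', hv', hdv⟩ := h₂ q.2.1 hq'.2.1
  obtain ⟨w', hw', hdw⟩ := h₃ q.2.2 hq'.2.2
  -- Moving the maximizer to the net one factor at a time costs (1 + 2 + 4)/16 of m, as net vectors
  -- have norm up to 2. Hence m ≤ (16/9) t.
  have key : m ≤ t + m * (7 / 16) := by
    have e1 : m = inner ℝ ξ (outer u' v' w') + (inner ℝ ξ (outer (q.1 - u') q.2.1 q.2.2) +
        inner ℝ ξ (outer u' (q.2.1 - v') q.2.2) + inner ℝ ξ (outer u' v' (q.2.2 - w'))) := by
      rw [← inner_add_right, ← inner_add_right, ← outer_sub_outer, ← inner_add_right, hm]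
      congr 1; abel
    have b1 : ‖q.1 - u'‖ * ‖q.2.1‖ * ‖q.2.2‖ ≤ (1 / 2) ^ 4 * 1 * 1 := by
      gcongr
      exacts [hq'.2.1, hq'.2.2]
    have b2 : ‖u'‖ * ‖q.2.1 - v'‖ * ‖q.2.2‖ ≤ 2 * (1 / 2) ^ 4 * 1 := by
      gcongr
      exacts [hb₁ _ hu', hq'.2.2]
    have b3 : ‖u'‖ * ‖v'‖ * ‖q.2.2 - w'‖ ≤ 2 * 2 * (1 / 2) ^ 4 := by
      gcongr
      exacts [hb₁ _ hu', hb₂ _ hv']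
    have c1 := (hom (q.1 - u') q.2.1 q.2.2).trans (mul_le_mul_of_nonneg_left b1 hm0)
    have c2 := (hom u' (q.2.1 - v') q.2.2).trans (mul_le_mul_of_nonneg_left b2 hm0)
    have c3 := (hom u' v' (q.2.2 - w')).trans (mul_le_mul_of_nonneg_left b3 hm0)
    have := h u' hu' v' hv' w' hw'
    norm_num at c1 c2 c3
    linarith
  refine (hom u v w).trans (mul_le_mul_of_nonneg_right (by linarith) (by positivity))

end Tensors

/-! ### Low-rank arrays and their nets -/

section LowRank

variable {α β γ : Type*} [Fintype α] [Fintype β] [Fintype γ]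

/-- The arrays `d` that are sums, indexed by `κ`, of rank-one arrays `u ⊗ v ⊗ w` with
`‖u‖, ‖v‖ ≤ 1` and `‖w‖ ≤ ‖d‖`. -/
def lowRank (κ : Type*) [Fintype κ] (α β γ : Type*) [Fintype α] [Fintype β] [Fintype γ] :
    Set (EuclideanSpace ℝ (α × β × γ)) :=
  {d | ∃ (u : κ → EuclideanSpace ℝ α) (v : κ → EuclideanSpace ℝ β) (w : κ → EuclideanSpace ℝ γ),
    (∀ i, ‖u i‖ ≤ 1 ∧ ‖v i‖ ≤ 1 ∧ ‖w i‖ ≤ ‖d‖) ∧ d = ∑ i, outer (u i) (v i) (w i)}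

variable {κ : Type*} [Fintype κ]

lemma smul_mem_lowRank {d : EuclideanSpace ℝ (α × β × γ)} (hd : d ∈ lowRank κ α β γ) (s : ℝ) :
    s • d ∈ lowRank κ α β γ := by
  obtain ⟨u, v, w, h, hd⟩ := hd
  refine ⟨u, v, fun i => s • w i, fun i => ⟨(h i).1, (h i).2.1, ?_⟩, ?_⟩
  · rw [norm_smul, norm_smul]
    exact mul_le_mul_of_nonneg_left (h i).2.2 (norm_nonneg _)
  · simp only [outer_smul_right, ← Finset.smul_sum, ← hd]

/-- The constraint ‖w i‖ ≤ ‖d‖ in `lowRank` matters here: it excludes large rank-one terms that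
cancel, so a bound on the injective norm yields one proportional to ‖d‖. -/
lemma inner_le_of_mem_lowRank {ξ d : EuclideanSpace ℝ (α × β × γ)} {t : ℝ} (ht : 0 ≤ t)
    (h : ∀ u v w, inner ℝ ξ (outer u v w) ≤ t * (‖u‖ * ‖v‖ * ‖w‖)) (hd : d ∈ lowRank κ α β γ) :
    inner ℝ ξ d ≤ Fintype.card κ * t * ‖d‖ := by
  obtain ⟨u, v, w, hb, hd⟩ := hd
  calc inner ℝ ξ d = ∑ i, inner ℝ ξ (outer (u i) (v i) (w i)) := by
        conv_lhs => rw [hd]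
        rw [inner_sum]
    _ ≤ ∑ _i : κ, t * ‖d‖ := by
        refine Finset.sum_le_sum fun i _ => (h _ _ _).trans (mul_le_mul_of_nonneg_left ?_ ht)
        calc ‖u i‖ * ‖v i‖ * ‖w i‖ ≤ 1 * 1 * ‖d‖ := by
              gcongr
              exacts [(hb i).1, (hb i).2.1, (hb i).2.2]
          _ = ‖d‖ := by ring
    _ = _ := by simp [mul_assoc]

/-- Entrywise truncation of an array to `[-M, M]`. -/
noncomputable def truncate {δ : Type*} (M : ℝ) (d : EuclideanSpace ℝ δ) : EuclideanSpace ℝ δ :=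
  WithLp.toLp 2 fun x => max (-M) (min M (d x))

lemma abs_truncate_le {δ : Type*} {M : ℝ} (hM : 0 ≤ M) (d : EuclideanSpace ℝ δ) (x : δ) :
    |truncate M d x| ≤ M := by
  rw [abs_le]
  exact ⟨le_max_left _ _, max_le (by linarith) (min_le_left _ _)⟩

lemma norm_le_norm_of_abs_le {δ : Type*} [Fintype δ] {d d' : EuclideanSpace ℝ δ}
    (h : ∀ x, |d x| ≤ |d' x|) : ‖d‖ ≤ ‖d'‖ := by
  refine (pow_le_pow_iff_left₀ (norm_nonneg _) (norm_nonneg _) two_ne_zero).1 ?_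
  simp only [EuclideanSpace.real_norm_sq_eq]
  exact Finset.sum_le_sum fun x _ => sq_le_sq.2 (h x)

/-- Clamping is 1-Lipschitz and fixes d. Net points may therefore be clamped to [-M, M], where the
densities are bounded below. -/
lemma norm_sub_truncate_le {δ : Type*} [Fintype δ] {M : ℝ} {d : EuclideanSpace ℝ δ}
    (hd : ∀ x, |d x| ≤ M) (z : EuclideanSpace ℝ δ) : ‖d - truncate M z‖ ≤ ‖d - z‖ := by
  refine norm_le_norm_of_abs_le fun x => ?_
  have h := abs_le.1 (hd x)
  simp only [PiLp.sub_apply, truncate]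
  rcases le_total (z x) M with h1 | h1
  · rw [min_eq_right h1]
    rcases le_total (-M) (z x) with h2 | h2
    · rw [max_eq_right h2]
    · rw [max_eq_left h2, abs_of_nonneg (by linarith), abs_of_nonneg (by linarith)]
      linarith
  · rw [min_eq_left h1, max_eq_right (by linarith), abs_of_nonpos (by linarith),
      abs_of_nonpos (by linarith)]
    linarith

/-- A net of the low-rank arrays of norm `D` with entries in `[-M, M]`, at scale `D / 2`. -/
lemma exists_net_lowRank {k : ℕ} (hk : 14 * Fintype.card κ ≤ 2 ^ k) {D M : ℝ} (hD : 0 < D)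
    (hM : 0 ≤ M) :
    ∃ N : Finset (EuclideanSpace ℝ (α × β × γ)),
      N.card ≤ ((5 ^ k) ^ (Fintype.card α + Fintype.card β + Fintype.card γ)) ^ Fintype.card κ ∧
      (∀ y ∈ N, ∀ x, |y x| ≤ M) ∧
      ∀ d ∈ lowRank κ α β γ, ‖d‖ = D → (∀ x, |d x| ≤ M) → ∃ y ∈ N, ‖d - y‖ ≤ D / 2 := by
  classical
  obtain ⟨N₁, hN₁, hb₁, hc₁⟩ := exists_net_unit_ball (EuclideanSpace ℝ α) k
  obtain ⟨N₂, hN₂, hb₂, hc₂⟩ := exists_net_unit_ball (EuclideanSpace ℝ β) k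
  obtain ⟨N₃, hN₃, -, hc₃⟩ := exists_net_unit_ball (EuclideanSpace ℝ γ) k
  rw [finrank_euclideanSpace] at hN₁ hN₂ hN₃
  refine ⟨(Fintype.piFinset fun _ : κ => N₁ ×ˢ (N₂ ×ˢ N₃)).image
    fun q => truncate M (∑ i, outer (q i).1 (q i).2.1 (D • (q i).2.2)), ?_, ?_, ?_⟩
  · refine Finset.card_image_le.trans ?_
    rw [Fintype.card_piFinset, Finset.prod_const, Finset.card_univ]
    refine Nat.pow_le_pow_left ?_ _
    rw [Finset.card_product, Finset.card_product, pow_add, pow_add, mul_assoc]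
    exact Nat.mul_le_mul hN₁ (Nat.mul_le_mul hN₂ hN₃)
  · intro y hy x
    obtain ⟨q, -, rfl⟩ := Finset.mem_image.1 hy
    exact abs_truncate_le hM _ _
  · rintro d ⟨u, v, w, hb, hd⟩ hdD hdM
    choose u' hu' hu'' using fun i => hc₁ (u i) (hb i).1
    choose v' hv' hv'' using fun i => hc₂ (v i) (hb i).2.1
    have hw : ∀ i, ‖D⁻¹ • w i‖ ≤ 1 := fun i => by
      rw [norm_smul, norm_inv, Real.norm_of_nonneg hD.le, inv_mul_le_iff₀ hD, mul_one, ← hdD]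
      exact (hb i).2.2
    choose w' hw' hw'' using fun i => hc₃ (D⁻¹ • w i) (hw i)
    refine ⟨_, Finset.mem_image_of_mem _ (a := fun i => (u' i, v' i, w' i))
      (by simp [hu', hv', hw']), ?_⟩
    refine (norm_sub_truncate_le hdM _).trans ?_
    -- Replacing the three factors in turn costs 1 + 2 + 4 = 7 units of 2⁻ᵏ D per term; 14 |κ| ≤ 2ᵏ
    -- brings the sum down to D/2.
    have hterm : ∀ i, ‖outer (u i) (v i) (w i) - outer (u' i) (v' i) (D • w' i)‖ ≤
        7 * (1 / 2) ^ k * D := by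
      intro i
      have e : outer (u i) (v i) (w i) = D • outer (u i) (v i) (D⁻¹ • w i) := by
        rw [← outer_smul_right, smul_smul, mul_inv_cancel₀ hD.ne', one_smul]
      rw [e, outer_smul_right (u' i), ← smul_sub, norm_smul, Real.norm_of_nonneg hD.le,
        mul_comm, outer_sub_outer]
      refine mul_le_mul_of_nonneg_right ?_ hD.le
      refine (norm_add₃_le).trans ?_
      rw [norm_outer, norm_outer, norm_outer]
      have b1 : ‖u i - u' i‖ * ‖v i‖ * ‖D⁻¹ • w i‖ ≤ (1 / 2) ^ k * 1 * 1 := by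
        gcongr
        exacts [hu'' i, (hb i).2.1, hw i]
      have b2 : ‖u' i‖ * ‖v i - v' i‖ * ‖D⁻¹ • w i‖ ≤ 2 * (1 / 2) ^ k * 1 := by
        gcongr
        exacts [hb₁ _ (hu' i), hv'' i, hw i]
      have b3 : ‖u' i‖ * ‖v' i‖ * ‖D⁻¹ • w i - w' i‖ ≤ 2 * 2 * (1 / 2) ^ k := by
        gcongr
        exacts [hb₁ _ (hu' i), hb₂ _ (hv' i), hw'' i]
      linarith
    rw [hd, ← Finset.sum_sub_distrib]
    refine (norm_sum_le _ _).trans ((Finset.sum_le_sum fun i _ => hterm i).trans ?_)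
    rw [Finset.sum_const, Finset.card_univ, nsmul_eq_mul]
    have hk' : (14 * Fintype.card κ : ℝ) ≤ 2 ^ k := by exact_mod_cast hk
    have h2 : (1 / 2 : ℝ) ^ k * 2 ^ k = 1 := by rw [← mul_pow]; norm_num
    have h3 : (1 / 2 : ℝ) ^ k * (14 * Fintype.card κ) ≤ 1 :=
      (mul_le_mul_of_nonneg_left hk' (by positivity)).trans h2.le
    nlinarith [mul_le_mul_of_nonneg_right h3 hD.le]

end LowRank

/-! ### The check loss and its random affine minorants -/

section CheckLoss

variable {τ : ℝ}

lemma checkLoss_of_nonpos {u : ℝ} (hu : u ≤ 0) : checkLoss τ u = (τ - 1) * u := by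
  simp [checkLoss, hu]

lemma checkLoss_of_nonneg {u : ℝ} (hu : 0 ≤ u) : checkLoss τ u = τ * u := by
  rcases hu.eq_or_lt with rfl | hu
  · simp [checkLoss]
  · simp [checkLoss, hu]

lemma checkLoss_eq_max (τ u : ℝ) : checkLoss τ u = max (τ * u) ((τ - 1) * u) := by
  rcases le_total u 0 with hu | hu
  · rw [checkLoss_of_nonpos hu, max_eq_right (by linarith)]
  · rw [checkLoss_of_nonneg hu, max_eq_left (by linarith)]

lemma continuous_checkLoss (τ : ℝ) : Continuous (checkLoss τ) := by
  have : checkLoss τ = fun u => max (τ * u) ((τ - 1) * u) := funext (checkLoss_eq_max τ)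
  rw [this]
  fun_prop

/-- Convexity of the loss increment along rays. -/
lemma checkLoss_sub_smul_le (τ e d : ℝ) {s : ℝ} (hs : 0 ≤ s) (hs1 : s ≤ 1) :
    checkLoss τ (e - s * d) - checkLoss τ e ≤ s * (checkLoss τ (e - d) - checkLoss τ e) := by
  have h1 := (checkLoss_eq_max τ (e - d)).symm.le
  have h2 := (checkLoss_eq_max τ e).symm.le
  rw [max_le_iff] at h1 h2
  have : checkLoss τ (e - s * d) ≤ s * checkLoss τ (e - d) + (1 - s) * checkLoss τ e := by
    rw [checkLoss_eq_max τ (e - s * d), max_le_iff]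
    constructor
    · nlinarith [mul_le_mul_of_nonneg_left h1.1 hs,
        mul_le_mul_of_nonneg_left h2.1 (sub_nonneg.2 hs1)]
    · nlinarith [mul_le_mul_of_nonneg_left h1.2 hs,
        mul_le_mul_of_nonneg_left h2.2 (sub_nonneg.2 hs1)]
  linarith

/-- Integration against a probability density `f` of a function weighted by `c / f`. -/
lemma integral_indicator_div_density {ν : Measure ℝ} {f : ℝ → ℝ} (hf : Measurable f)
    (hν : ν = volume.withDensity fun u => ENNReal.ofReal (f u)) {c : ℝ} (hc : 0 < c) {a b : ℝ}
    (hab : a ≤ b) (hcf : ∀ u ∈ Set.Ioc a b, c ≤ f u) (φ : ℝ → ℝ) :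
    ∫ e, (Set.Ioc a b).indicator (fun u => c / f u) e * φ e ∂ν = c * ∫ u in a..b, φ u := by
  rw [hν, integral_withDensity_eq_integral_toReal_smul hf.ennreal_ofReal (by simp),
    intervalIntegral.integral_of_le hab, ← integral_const_mul, ← integral_indicator measurableSet_Ioc]
  refine integral_congr_ae (ae_of_all _ fun u => ?_)
  by_cases hu : u ∈ Set.Ioc a b
  · have : 0 < f u := hc.trans_le (hcf u hu)
    simp only [Set.indicator_of_mem hu, ENNReal.toReal_ofReal this.le, smul_eq_mul]
    field_simp
  · simp [Set.indicator_of_notMem hu]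

lemma indicator_div_mem_Icc {f : ℝ → ℝ} {c : ℝ} (hc : 0 < c) {a b : ℝ}
    (hcf : ∀ u ∈ Set.Ioc a b, c ≤ f u) (e : ℝ) :
    0 ≤ (Set.Ioc a b).indicator (fun u => c / f u) e ∧
      (Set.Ioc a b).indicator (fun u => c / f u) e ≤ 1 := by
  by_cases he : e ∈ Set.Ioc a b
  · have : 0 < f e := hc.trans_le (hcf e he)
    rw [Set.indicator_of_mem he]
    exact ⟨by positivity, (div_le_one this).2 (hcf e he)⟩
  · simp [Set.indicator_of_notMem he]

/-- A random affine minorant `d ↦ b(e) + G(e) d` of the check-loss increment whose mean is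
`c (y d - y² / 2)`, for an error with `τ`-quantile zero whose density is at least `c` on
`[-M, M] ∋ y`. -/
lemma exists_affine_minorant (hτ : τ ∈ Set.Ioo (0 : ℝ) 1) {ν : Measure ℝ} [IsProbabilityMeasure ν]
    {f : ℝ → ℝ} (hf : Measurable f) (hν : ν = volume.withDensity fun u => ENNReal.ofReal (f u))
    (hq : ν (Set.Iic 0) = ENNReal.ofReal τ) {c M : ℝ} (hc : 0 < c)
    (hcf : ∀ u ∈ Set.Icc (-M) M, c ≤ f u) {y : ℝ} (hy : |y| ≤ M) :
    ∃ b G : ℝ → ℝ, Measurable b ∧ Measurable G ∧ (∀ e, |b e| ≤ |y|) ∧ (∀ e, |G e| ≤ 1) ∧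
      (∀ e d, b e + G e * d ≤ checkLoss τ (e - d) - checkLoss τ e) ∧
      ∫ e, G e ∂ν = c * y ∧ ∫ e, b e ∂ν = -(c * y ^ 2 / 2) := by
  obtain ⟨hτ0, hτ1⟩ := hτ
  have hyM := abs_le.1 hy
  -- The loss is the maximum of lines of slopes τ and τ - 1, so every convex combination of them is
  -- a minorant. For errors between 0 and y the line not active at e gets weight q = c/f(e);
  -- elsewhere only the active line is used. Integrating q against the density f leaves the constant
  -- c, so the means are those of density exactly c: slope cy and intercept -cy²/2. The indicator
  -- `I` contributes τ, which cancels the constant in the slope.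
  let I : ℝ → ℝ := (Set.Iic (0 : ℝ)).indicator fun _ => 1
  have hIm : Measurable I := measurable_const.indicator measurableSet_Iic
  have hIint : ∫ e, I e ∂ν = τ := by
    simp only [I]
    rw [integral_indicator_const _ measurableSet_Iic, measureReal_def, hq,
      ENNReal.toReal_ofReal hτ0.le, smul_eq_mul, mul_one]
  have hIi : Integrable I ν := (integrable_const (1 : ℝ)).indicator measurableSet_Iic
  have lin : ∀ e d : ℝ, τ * (e - d) ≤ checkLoss τ (e - d) ∧
      (τ - 1) * (e - d) ≤ checkLoss τ (e - d) := fun e d => by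
    rw [checkLoss_eq_max]; exact ⟨le_max_left _ _, le_max_right _ _⟩
  have bdd : ∀ q : ℝ → ℝ, Measurable q → (∀ e, 0 ≤ q e ∧ q e ≤ 1) → Integrable q ν :=
    fun q hqm hq01 => Integrable.of_bound hqm.aestronglyMeasurable 1
      (ae_of_all _ fun e => by rw [Real.norm_of_nonneg (hq01 e).1]; exact (hq01 e).2)
  rcases le_total 0 y with h0 | h0
  · have hcf' : ∀ u ∈ Set.Ioc 0 y, c ≤ f u := fun u hu =>
      hcf u ⟨by linarith [hu.1], by linarith [hu.2]⟩
    set q : ℝ → ℝ := (Set.Ioc 0 y).indicator fun u => c / f u with hqdef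
    have hqm : Measurable q := (measurable_const.div hf).indicator measurableSet_Ioc
    have hq01 : ∀ e, 0 ≤ q e ∧ q e ≤ 1 := indicator_div_mem_Icc hc hcf'
    have hq0 : ∀ e, e ∉ Set.Ioc 0 y → q e = 0 := fun e he => Set.indicator_of_notMem he _
    refine ⟨fun e => -(q e * e), fun e => q e + I e - τ, by fun_prop, by fun_prop, fun e => ?_,
      fun e => ?_, fun e d => ?_, ?_, ?_⟩
    · by_cases he : e ∈ Set.Ioc 0 y
      · rw [abs_neg, abs_of_nonneg (mul_nonneg (hq01 e).1 he.1.le), abs_of_nonneg h0]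
        exact (mul_le_of_le_one_left he.1.le (hq01 e).2).trans he.2
      · simp [hq0 e he]
    · rw [abs_le]
      by_cases he : e ≤ 0
      · have : I e = 1 := Set.indicator_of_mem (s := Set.Iic (0 : ℝ)) he _
        simp only [this, hq0 e fun h => absurd h.1 (by linarith)]
        constructor <;> linarith
      · have : I e = 0 := Set.indicator_of_notMem (s := Set.Iic (0 : ℝ)) he _
        simp only [this]
        constructor <;> linarith [hq01 e]
    · obtain ⟨l1, l2⟩ := lin e d
      by_cases he : e ≤ 0
      · have : I e = 1 := Set.indicator_of_mem (s := Set.Iic (0 : ℝ)) he _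
        simp only [this, hq0 e fun h => absurd h.1 (by linarith), checkLoss_of_nonpos he]
        linarith
      · have : I e = 0 := Set.indicator_of_notMem (s := Set.Iic (0 : ℝ)) he _
        simp only [this, checkLoss_of_nonneg (not_le.1 he).le]
        nlinarith [mul_le_mul_of_nonneg_left l1 (sub_nonneg.2 (hq01 e).2),
          mul_le_mul_of_nonneg_left l2 (hq01 e).1]
    · have hqi := bdd q hqm hq01
      have e1 : ∫ e, q e + I e - τ ∂ν = ∫ e, q e + I e ∂ν - ∫ _, τ ∂ν :=
        integral_sub (hqi.add hIi) (integrable_const _)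
      have e2 : ∫ e, q e + I e ∂ν = ∫ e, q e ∂ν + τ := hIint ▸ integral_add hqi hIi
      have := integral_indicator_div_density hf hν hc h0 hcf' fun _ => 1
      simp only [mul_one] at this
      rw [← hqdef] at this
      rw [e1, e2, this]
      simp
    · rw [integral_neg, hqdef, integral_indicator_div_density hf hν hc h0 hcf' fun e => e,
        integral_id]
      ring
  · have hcf' : ∀ u ∈ Set.Ioc y 0, c ≤ f u := fun u hu =>
      hcf u ⟨by linarith [hu.1], by linarith [hu.2]⟩
    set q : ℝ → ℝ := (Set.Ioc y 0).indicator fun u => c / f u with hqdef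
    have hqm : Measurable q := (measurable_const.div hf).indicator measurableSet_Ioc
    have hq01 : ∀ e, 0 ≤ q e ∧ q e ≤ 1 := indicator_div_mem_Icc hc hcf'
    have hq0 : ∀ e, e ∉ Set.Ioc y 0 → q e = 0 := fun e he => Set.indicator_of_notMem he _
    refine ⟨fun e => q e * e, fun e => I e - q e - τ, by fun_prop, by fun_prop, fun e => ?_,
      fun e => ?_, fun e d => ?_, ?_, ?_⟩
    · by_cases he : e ∈ Set.Ioc y 0
      · rw [abs_of_nonpos (mul_nonpos_of_nonneg_of_nonpos (hq01 e).1 he.2), abs_of_nonpos h0]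
        nlinarith [he.1, he.2, (hq01 e).1, (hq01 e).2]
      · simp [hq0 e he]
    · rw [abs_le]
      by_cases he : e ≤ 0
      · have : I e = 1 := Set.indicator_of_mem (s := Set.Iic (0 : ℝ)) he _
        simp only [this]
        constructor <;> linarith [hq01 e]
      · have : I e = 0 := Set.indicator_of_notMem (s := Set.Iic (0 : ℝ)) he _
        simp only [this, hq0 e fun h => absurd h.2 he]
        constructor <;> linarith
    · obtain ⟨l1, l2⟩ := lin e d
      by_cases he : e ≤ 0
      · have : I e = 1 := Set.indicator_of_mem (s := Set.Iic (0 : ℝ)) he _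
        simp only [this, checkLoss_of_nonpos he]
        nlinarith [mul_le_mul_of_nonneg_left l2 (sub_nonneg.2 (hq01 e).2),
          mul_le_mul_of_nonneg_left l1 (hq01 e).1]
      · have : I e = 0 := Set.indicator_of_notMem (s := Set.Iic (0 : ℝ)) he _
        simp only [this, hq0 e fun h => absurd h.2 he, checkLoss_of_nonneg (not_le.1 he).le]
        linarith
    · have hqi := bdd q hqm hq01
      have e1 : ∫ e, I e - q e - τ ∂ν = ∫ e, I e - q e ∂ν - ∫ _, τ ∂ν :=
        integral_sub (hIi.sub hqi) (integrable_const _)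
      have e2 : ∫ e, I e - q e ∂ν = τ - ∫ e, q e ∂ν := hIint ▸ integral_sub hIi hqi
      have := integral_indicator_div_density hf hν hc h0 hcf' fun _ => 1
      simp only [mul_one] at this
      rw [← hqdef] at this
      rw [e1, e2, this]
      simp
    · rw [hqdef, integral_indicator_div_density hf hν hc h0 hcf' fun e => e, integral_id]
      ring

end CheckLoss

/-! ### Hoeffding's inequality -/

section Hoeffding

/-- **Hoeffding's inequality** for independent coordinates with coordinatewise bounds. -/
lemma measureReal_sum_sub_integral_ge_le {δ Ω : Type*} [Fintype δ] [MeasurableSpace Ω]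
    {P : Measure Ω} {Z : δ → Ω → ℝ} (hZ : ∀ x, Measurable (Z x)) (hind : iIndepFun Z P) {a : δ → ℝ}
    (ha : ∀ x ω, |Z x ω| ≤ a x) {v t : ℝ} (hv : ∑ x, a x ^ 2 ≤ v) (hv0 : 0 < v) (ht : 0 ≤ t) :
    P.real {ω | t ≤ ∑ x, (Z x ω - ∫ ω', Z x ω' ∂P)} ≤ Real.exp (-t ^ 2 / (2 * v)) := by
  have hP := hind.isProbabilityMeasure
  have hsub : ∀ x, HasSubgaussianMGF (fun ω => Z x ω - ∫ ω', Z x ω' ∂P)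
      ((‖a x - -a x‖₊ / 2) ^ 2) P := fun x =>
    hasSubgaussianMGF_of_mem_Icc (hZ x).aemeasurable (ae_of_all _ fun ω => abs_le.1 (ha x ω))
  have hind' : iIndepFun (fun x ω => Z x ω - ∫ ω', Z x ω' ∂P) P :=
    hind.comp (fun x z => z - ∫ ω', Z x ω' ∂P) fun x => by fun_prop
  have hconst : ∀ x, (((‖a x - -a x‖₊ / 2) ^ 2 : NNReal) : ℝ) = a x ^ 2 := fun x => by
    push_cast
    rw [Real.norm_eq_abs, div_pow, sq_abs]; ring
  have hsum := HasSubgaussianMGF.sum_of_iIndepFun hind' (s := Finset.univ) fun x _ => hsub x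
  have hmono : ((∑ x, ((‖a x - -a x‖₊ / 2) ^ 2 : NNReal) : NNReal) : ℝ) ≤ v := by
    rw [NNReal.coe_sum]; simpa only [hconst] using hv
  -- A variance proxy may be enlarged, so the upper bound v can replace the exact sum of the squares
  -- a x².
  have hsub' : HasSubgaussianMGF (fun ω => ∑ x, (Z x ω - ∫ ω', Z x ω' ∂P)) v.toNNReal P := by
    refine ⟨hsum.integrable_exp_mul, fun s => (hsum.mgf_le s).trans (Real.exp_le_exp.2 ?_)⟩
    rw [Real.coe_toNNReal v hv0.le]
    gcongr
  simpa [Real.coe_toNNReal v hv0.le] using hsub'.measure_ge_le ht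

end Hoeffding

/-! ### Uniform lower bounds for the excess loss -/

section Excess

variable {α β γ : Type*} [Fintype α] [Fintype β] [Fintype γ]

/-- The total increment of the check loss when the errors `e` are shifted by the array `d`. -/
noncomputable def excess {δ : Type*} [Fintype δ] (τ : ℝ) (e : δ → ℝ) (d : EuclideanSpace ℝ δ) : ℝ :=
  ∑ x, (checkLoss τ (e x - d x) - checkLoss τ (e x))

lemma continuous_excess {δ : Type*} [Fintype δ] (τ : ℝ) (d : EuclideanSpace ℝ δ) :
    Continuous fun e => excess τ e d := by
  refine continuous_finsetSum _ fun x _ => ?_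
  exact ((continuous_checkLoss τ).comp (by fun_prop)).sub
    ((continuous_checkLoss τ).comp (by fun_prop))

lemma excess_smul_le {δ : Type*} [Fintype δ] (τ : ℝ) (e : δ → ℝ) (d : EuclideanSpace ℝ δ) {s : ℝ}
    (hs : 0 ≤ s) (hs1 : s ≤ 1) : excess τ e (s • d) ≤ s * excess τ e d := by
  rw [excess, excess, Finset.mul_sum]
  exact Finset.sum_le_sum fun x _ => checkLoss_sub_smul_le τ _ _ hs hs1

/-- The injective norm of an array of centred, independent variables bounded by one is at most of
the order of the square root of the sum of the dimensions. -/
lemma measureReal_exists_inner_outer_gt_le {Ω : Type*} [MeasurableSpace Ω] {P : Measure Ω}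
    {Z : α × β × γ → Ω → ℝ} (hZ : ∀ x, Measurable (Z x)) (hind : iIndepFun Z P)
    (hb : ∀ x ω, |Z x ω| ≤ 1) {t : ℝ} (ht : 0 ≤ t) :
    P.real {ω | ¬ ∀ u v w, inner ℝ (WithLp.toLp 2 fun x => Z x ω - ∫ ω', Z x ω' ∂P)
        (outer u v w) ≤ 2 * t * (‖u‖ * ‖v‖ * ‖w‖)} ≤
      ((5 ^ 4) ^ (Fintype.card α + Fintype.card β + Fintype.card γ) : ℕ) *
        Real.exp (-t ^ 2 / 128) := by
  have hP := hind.isProbabilityMeasure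
  obtain ⟨N₁, hN₁, hb₁, hc₁⟩ := exists_net_unit_ball (EuclideanSpace ℝ α) 4
  obtain ⟨N₂, hN₂, hb₂, hc₂⟩ := exists_net_unit_ball (EuclideanSpace ℝ β) 4
  obtain ⟨N₃, hN₃, hb₃, hc₃⟩ := exists_net_unit_ball (EuclideanSpace ℝ γ) 4
  rw [finrank_euclideanSpace] at hN₁ hN₂ hN₃
  have hcard : ((N₁ ×ˢ N₂ ×ˢ N₃).card : ℝ) ≤
      ((5 ^ 4) ^ (Fintype.card α + Fintype.card β + Fintype.card γ) : ℕ) := by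
    rw [Finset.card_product, Finset.card_product, pow_add, pow_add, mul_assoc]
    exact_mod_cast Nat.mul_le_mul hN₁ (Nat.mul_le_mul hN₂ hN₃)
  let Ev : EuclideanSpace ℝ α × EuclideanSpace ℝ β × EuclideanSpace ℝ γ → Set Ω := fun q =>
    {ω | t ≤ inner ℝ (WithLp.toLp 2 fun x => Z x ω - ∫ ω', Z x ω' ∂P) (outer q.1 q.2.1 q.2.2)}
  have hEv : ∀ q ∈ N₁ ×ˢ N₂ ×ˢ N₃, P.real (Ev q) ≤ Real.exp (-t ^ 2 / 128) := by
    intro q hq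
    simp only [Finset.mem_product] at hq
    -- Net vectors have norm at most 2, so the coefficients have squared norm at most 8² = 64;
    -- Hoeffding then gives the exponent 128 = 2 · 64.
    have hn : ∑ x, |outer q.1 q.2.1 q.2.2 x| ^ 2 ≤ 64 := by
      simp only [sq_abs]
      rw [← EuclideanSpace.real_norm_sq_eq, norm_outer]
      have : ‖q.1‖ * ‖q.2.1‖ * ‖q.2.2‖ ≤ 2 * 2 * 2 := by
        gcongr
        exacts [hb₁ _ hq.1, hb₂ _ hq.2.1, hb₃ _ hq.2.2]
      calc (‖q.1‖ * ‖q.2.1‖ * ‖q.2.2‖) ^ 2 ≤ (2 * 2 * 2) ^ 2 := by gcongr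
        _ = 64 := by norm_num
    have := measureReal_sum_sub_integral_ge_le (P := P)
      (Z := fun x ω => outer q.1 q.2.1 q.2.2 x * Z x ω) (fun x => (hZ x).const_mul _)
      (hind.comp (fun x z => outer q.1 q.2.1 q.2.2 x * z) fun x => by fun_prop)
      (a := fun x => |outer q.1 q.2.1 q.2.2 x|)
      (fun x ω => by rw [abs_mul]; exact mul_le_of_le_one_right (abs_nonneg _) (hb x ω))
      hn (by norm_num) ht
    have e1 : ∀ ω, inner ℝ (WithLp.toLp 2 fun x => Z x ω - ∫ ω', Z x ω' ∂P)
        (outer q.1 q.2.1 q.2.2) = ∑ x, (outer q.1 q.2.1 q.2.2 x * Z x ω -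
          ∫ ω', outer q.1 q.2.1 q.2.2 x * Z x ω' ∂P) := fun ω => by
      rw [PiLp.inner_apply]
      refine Finset.sum_congr rfl fun x _ => ?_
      rw [integral_const_mul, ← mul_sub]
      rfl
    have e2 : (2 * 64 : ℝ) = 128 := by norm_num
    rw [e2] at this
    simpa only [Ev, e1] using this
  calc _ ≤ P.real (⋃ q ∈ N₁ ×ˢ N₂ ×ˢ N₃, Ev q) := by
        refine measureReal_mono (fun ω hω => ?_) (measure_ne_top _ _)
        by_contra hcon
        simp only [Set.mem_iUnion, not_exists, Ev, Set.mem_ofPred_eq, not_le] at hcon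
        refine hω fun u v w => inner_outer_le_of_net hc₁ hc₂ hc₃ hb₁ hb₂ _ ht ?_ u v w
        intro u hu v hv w hw
        exact (hcon (u, v, w) (by simp [hu, hv, hw])).le
    _ ≤ ∑ q ∈ N₁ ×ˢ N₂ ×ˢ N₃, P.real (Ev q) := measureReal_biUnion_finset_le _ _
    _ ≤ ∑ _q ∈ N₁ ×ˢ N₂ ×ˢ N₃, Real.exp (-t ^ 2 / 128) := Finset.sum_le_sum hEv
    _ ≤ _ := by
        rw [Finset.sum_const, nsmul_eq_mul]
        exact mul_le_mul_of_nonneg_right hcard (Real.exp_nonneg _)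

/-- The errors `e` are independent under `P`, with `τ`-quantile zero and densities `f x` that are at
least `c` on `[-M, M]`. -/
structure IsErrorLaw {δ : Type*} (P : Measure (δ → ℝ)) (τ c M : ℝ) (f : δ → ℝ → ℝ) : Prop where
  indep : iIndepFun (fun x (e : δ → ℝ) => e x) P
  density : ∀ x, Measurable (f x) ∧
    P.map (fun e => e x) = volume.withDensity fun u => ENNReal.ofReal (f x u)
  quantile : ∀ x, P {e | e x ≤ 0} = ENNReal.ofReal τ
  le_density : ∀ x, ∀ u ∈ Set.Icc (-M) M, c ≤ f x u

variable {κ : Type*} [Fintype κ]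

/-- The lower bound for the excess loss obtained from the random affine minorant at `y`. -/
lemma measureReal_not_excess_ge_le {P : Measure (α × β × γ → ℝ)} {τ c M : ℝ}
    {f : α × β × γ → ℝ → ℝ} (hP : IsErrorLaw P τ c M f) (hτ : τ ∈ Set.Ioo (0 : ℝ) 1) (hc : 0 < c)
    {t : ℝ} (ht : 0 ≤ t) {y : EuclideanSpace ℝ (α × β × γ)} (hy : ∀ x, |y x| ≤ M) :
    P.real {e | ¬ ∀ d ∈ lowRank κ α β γ,
        c / 2 * (‖d‖ ^ 2 - ‖d - y‖ ^ 2) - t * ‖y‖ - 2 * t * Fintype.card κ * ‖d‖ ≤ excess τ e d} ≤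
      (((5 ^ 4) ^ (Fintype.card α + Fintype.card β + Fintype.card γ) : ℕ) + 1) *
        Real.exp (-t ^ 2 / 128) := by
  have hPp := hP.indep.isProbabilityMeasure
  have hev : ∀ x : α × β × γ, Measurable fun e : α × β × γ → ℝ => e x := measurable_pi_apply
  have hmap : ∀ x, IsProbabilityMeasure (P.map fun e => e x) := fun x =>
    Measure.isProbabilityMeasure_map (hev x).aemeasurable
  have hex : ∀ x, ∃ b G : ℝ → ℝ, Measurable b ∧ Measurable G ∧ (∀ e, |b e| ≤ |y x|) ∧
      (∀ e, |G e| ≤ 1) ∧ (∀ e d, b e + G e * d ≤ checkLoss τ (e - d) - checkLoss τ e) ∧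
      ∫ e, G e ∂(P.map fun e => e x) = c * y x ∧
      ∫ e, b e ∂(P.map fun e => e x) = -(c * y x ^ 2 / 2) := fun x => by
    refine exists_affine_minorant hτ (hP.density x).1 (hP.density x).2 ?_ hc (hP.le_density x) (hy x)
    rw [Measure.map_apply (hev x) measurableSet_Iic]
    exact hP.quantile x
  choose b G hbm hGm hb hG hmin hGint hbint using hex
  have hGint' : ∀ x, ∫ e, G x (e x) ∂P = c * y x := fun x => by
    rw [← hGint x, integral_map (hev x).aemeasurable (hGm x).aestronglyMeasurable]
  have hbint' : ∀ x, ∫ e, b x (e x) ∂P = -(c * y x ^ 2 / 2) := fun x => by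
    rw [← hbint x, integral_map (hev x).aemeasurable (hbm x).aestronglyMeasurable]
  -- Only the slope noise ξ meets the variable d, and the injective norm controls it for all d. The
  -- intercept noise depends on y alone and needs a single Hoeffding bound.
  set ξ : (α × β × γ → ℝ) → EuclideanSpace ℝ (α × β × γ) := fun e =>
    -(WithLp.toLp 2 fun x => G x (e x) - ∫ e', G x (e' x) ∂P) with hξ
  have h1 : P.real {e | ¬ ∀ u v w, inner ℝ (ξ e) (outer u v w) ≤ 2 * t * (‖u‖ * ‖v‖ * ‖w‖)} ≤
      ((5 ^ 4) ^ (Fintype.card α + Fintype.card β + Fintype.card γ) : ℕ) *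
        Real.exp (-t ^ 2 / 128) := by
    have := measureReal_exists_inner_outer_gt_le (P := P) (Z := fun x e => -G x (e x))
      (fun x => ((hGm x).comp (hev x)).neg) (hP.indep.comp (fun x z => -G x z) fun x => (hGm x).neg)
      (fun x e => by rw [abs_neg]; exact hG x _) ht
    have e1 : ∀ e, ξ e = WithLp.toLp 2 fun x => -G x (e x) - ∫ e', -G x (e' x) ∂P := fun e => by
      ext x; simp [hξ, integral_neg]; ring
    simpa only [e1] using this
  have h2 : P.real {e | t * ‖y‖ < ∑ x, (-b x (e x) - ∫ e', -b x (e' x) ∂P)} ≤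
      Real.exp (-t ^ 2 / 128) := by
    -- Hoeffding is applied with variance proxy ‖y‖² > 0; at y = 0 the intercepts vanish
    -- identically.
    rcases eq_or_ne y 0 with hy0 | hy0
    · have hb0 : ∀ x e, b x e = 0 := fun x e => by simpa [hy0] using hb x e
      simp [hb0, hy0, Real.exp_nonneg]
    · have hyn : 0 < ‖y‖ := norm_pos_iff.2 hy0
      have := measureReal_sum_sub_integral_ge_le (P := P) (Z := fun x e => -b x (e x))
        (fun x => ((hbm x).comp (hev x)).neg)
        (hP.indep.comp (fun x z => -b x z) fun x => (hbm x).neg) (a := fun x => |y x|)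
        (fun x e => by rw [abs_neg]; exact hb x _) (v := ‖y‖ ^ 2)
        (by simp [EuclideanSpace.real_norm_sq_eq]) (by positivity)
        (mul_nonneg ht hyn.le)
      refine le_trans (measureReal_mono ?_ (measure_ne_top _ _)) (this.trans (Real.exp_le_exp.2 ?_))
      · intro e he
        simp only [Set.mem_ofPred_eq] at he ⊢
        exact he.le
      rw [mul_pow, neg_div, neg_div, neg_le_neg_iff, mul_comm 2, mul_comm (t ^ 2),
        mul_div_mul_left _ _ (by positivity)]
      gcongr
      norm_num
  calc _ ≤ P.real ({e | ¬ ∀ u v w, inner ℝ (ξ e) (outer u v w) ≤ 2 * t * (‖u‖ * ‖v‖ * ‖w‖)} ∪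
        {e | t * ‖y‖ < ∑ x, (-b x (e x) - ∫ e', -b x (e' x) ∂P)}) := by
        refine measureReal_mono (fun e he => ?_) (measure_ne_top _ _)
        by_contra hcon
        simp only [Set.mem_union, Set.mem_ofPred_eq, not_or, not_not, not_lt] at hcon
        obtain ⟨hA, hB⟩ := hcon
        refine he fun d hd => ?_
        have hA' := inner_le_of_mem_lowRank (by positivity) hA hd
        have hlow : ∑ x, (b x (e x) + G x (e x) * d x) ≤ excess τ e d :=
          Finset.sum_le_sum fun x _ => hmin x _ _
        refine le_trans ?_ hlow
        -- The mean part is c(y d - y²/2) in each entry, which is (c/2)(d² - (d - y)²).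
        have e1 : ∑ x, (b x (e x) + G x (e x) * d x) =
            c / 2 * (‖d‖ ^ 2 - ‖d - y‖ ^ 2) - inner ℝ (ξ e) d -
              ∑ x, (-b x (e x) - ∫ e', -b x (e' x) ∂P) := by
          simp only [EuclideanSpace.real_norm_sq_eq, PiLp.inner_apply, hξ, integral_neg, hbint',
            hGint', ← Finset.sum_sub_distrib, Finset.mul_sum]
          refine Finset.sum_congr rfl fun x _ => ?_
          simp
          ring
        rw [e1]
        linarith
    _ ≤ _ := (measureReal_union_le _ _).trans (by linarith)

/-- The constant in front of the noise level for sums of `r` rank-one arrays. -/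
noncomputable def noiseConst (r : ℕ) : ℝ := (2 + 2 * r) * √(128 * (28 * r ^ 2 + 11))

lemma noiseConst_pos (r : ℕ) : 0 < noiseConst r := by unfold noiseConst; positivity

/-- The errors for which the excess loss of every low-rank array with entries in `[-M, M]` is at
least minus the noise level, and of those of norm `D` exceeds a quadratic minus the noise level. -/
def goodErrors (κ : Type*) [Fintype κ] (α β γ : Type*) [Fintype α] [Fintype β] [Fintype γ]
    (τ c M D : ℝ) : Set (α × β × γ → ℝ) :=
  {e | ∀ d ∈ lowRank κ α β γ, (∀ x, |d x| ≤ M) →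
    -(noiseConst (Fintype.card κ) *
      √(Fintype.card α + Fintype.card β + Fintype.card γ : ℕ) * ‖d‖) ≤ excess τ e d ∧
    (‖d‖ = D → 3 * c / 8 * D ^ 2 - noiseConst (Fintype.card κ) *
      √(Fintype.card α + Fintype.card β + Fintype.card γ : ℕ) * D ≤ excess τ e d)}

/-- This supplies measurability: the event is an intersection over uncountably many d, but each
excess loss is continuous in the errors. -/
lemma isClosed_goodErrors (τ c M D : ℝ) : IsClosed (goodErrors κ α β γ τ c M D) := by
  simp only [goodErrors, Set.ofPred_forall, Set.ofPred_and]
  refine isClosed_iInter fun d => isClosed_iInter fun _ => isClosed_iInter fun _ => IsClosed.inter ?_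
    (isClosed_iInter fun _ => ?_)
  · exact isClosed_le continuous_const (continuous_excess τ d)
  · exact isClosed_le continuous_const (continuous_excess τ d)

/-- Union bound over y = 0 and the net. Both the number of net points and the failure probability at
each are exponential in S, and `noiseConst` makes the decay win. -/
lemma measureReal_compl_goodErrors_le {P : Measure (α × β × γ → ℝ)} {τ c M D : ℝ}
    {f : α × β × γ → ℝ → ℝ} (hP : IsErrorLaw P τ c M f) (hτ : τ ∈ Set.Ioo (0 : ℝ) 1) (hc : 0 < c)
    (hM : 0 ≤ M) (hD : 0 < D)
    (hS : 1 ≤ Fintype.card α + Fintype.card β + Fintype.card γ) :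
    P.real (goodErrors κ α β γ τ c M D)ᶜ ≤
      Real.exp (-(Fintype.card α + Fintype.card β + Fintype.card γ : ℕ)) := by
  classical
  have hPp := hP.indep.isProbabilityMeasure
  set S := Fintype.card α + Fintype.card β + Fintype.card γ with hSdef
  set r := Fintype.card κ with hr
  have hk : 14 * Fintype.card κ ≤ 2 ^ (14 * r) := Nat.lt_two_pow_self.le
  obtain ⟨N, hN, hNM, hNnet⟩ := exists_net_lowRank (α := α) (β := β) (γ := γ) hk hD hM
  -- The net of arrays costs 5^(14r²S) ≤ exp(28r²S), the nets of vectors 5^(4S) ≤ exp(8S), and two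
  -- factors 2 cost exp(2S). With t²/128 = (28r² + 11)S, exp(-S) remains.
  set t := √(128 * (28 * r ^ 2 + 11)) * √S with ht
  have ht0 : 0 ≤ t := by positivity
  let Bad : EuclideanSpace ℝ (α × β × γ) → Set (α × β × γ → ℝ) := fun y =>
    {e | ¬ ∀ d ∈ lowRank κ α β γ,
        c / 2 * (‖d‖ ^ 2 - ‖d - y‖ ^ 2) - t * ‖y‖ - 2 * t * Fintype.card κ * ‖d‖ ≤ excess τ e d}
  have hBad : ∀ y ∈ insert 0 N, P.real (Bad y) ≤ (((5 ^ 4) ^ S : ℕ) + 1) * Real.exp (-t ^ 2 / 128) := by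
    intro y hy
    refine measureReal_not_excess_ge_le hP hτ hc ht0 fun x => ?_
    rcases Finset.mem_insert.1 hy with rfl | hy
    · simpa using hM
    · exact hNM y hy x
  have hnoise : noiseConst r * √S = (2 + 2 * r) * t := by rw [noiseConst, ht]; ring
  -- At y = 0 the quadratic part vanishes and the linear bound is left. At a net point with ‖d - y‖
  -- ≤ D/2 it is at least (c/2)(D² - D²/4) = 3cD²/8.
  have hsub : (goodErrors κ α β γ τ c M D)ᶜ ⊆ ⋃ y ∈ insert 0 N, Bad y := by
    intro e he
    by_contra hcon
    simp only [Set.mem_iUnion, not_exists, Bad, Set.mem_ofPred_eq, not_not] at hcon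
    refine he fun d hd hdM => ⟨?_, fun hdD => ?_⟩
    · have := hcon 0 (Finset.mem_insert_self _ _) d hd
      rw [hnoise]
      simp only [sub_zero, sub_self, mul_zero, norm_zero, zero_sub, ← hr] at this
      nlinarith [mul_nonneg ht0 (norm_nonneg d)]
    · obtain ⟨y, hyN, hyd⟩ := hNnet d hd hdD hdM
      have := hcon y (Finset.mem_insert_of_mem hyN) d hd
      rw [hnoise]
      refine le_trans ?_ this
      have hyn : ‖y‖ ≤ 2 * D := by
        have := norm_sub_norm_le y d
        rw [norm_sub_rev] at this
        linarith
      have hsq : ‖d - y‖ ^ 2 ≤ (D / 2) ^ 2 := by gcongr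
      rw [hdD]
      nlinarith [mul_le_mul_of_nonneg_left hyn ht0, mul_le_mul_of_nonneg_left hsq hc.le]
  have hexp5 : (5 : ℝ) ≤ Real.exp 2 := by
    have := Real.quadratic_le_exp_of_nonneg (x := 2) (by norm_num)
    linarith
  have hpow5 : ∀ m : ℕ, (5 : ℝ) ^ m ≤ Real.exp (2 * m) := fun m => by
    rw [mul_comm, Real.exp_nat_mul]; gcongr
  have hone : ∀ m : ℕ, (1 : ℝ) ≤ 5 ^ m := fun m => one_le_pow₀ (by norm_num)
  have hS' : (1 : ℝ) ≤ S := by exact_mod_cast hS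
  have ht2 : t ^ 2 = 128 * (28 * r ^ 2 + 11) * S := by
    rw [ht, mul_pow, Real.sq_sqrt (by positivity), Real.sq_sqrt (by positivity)]
  calc P.real (goodErrors κ α β γ τ c M D)ᶜ ≤ P.real (⋃ y ∈ insert 0 N, Bad y) :=
        measureReal_mono hsub (measure_ne_top _ _)
    _ ≤ ∑ y ∈ insert 0 N, P.real (Bad y) := measureReal_biUnion_finset_le _ _
    _ ≤ (insert 0 N).card * ((((5 ^ 4) ^ S : ℕ) + 1) * Real.exp (-t ^ 2 / 128)) := by
        rw [← nsmul_eq_mul, ← Finset.sum_const]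
        exact Finset.sum_le_sum hBad
    _ ≤ (2 * 5 ^ (14 * r * S * r)) * ((2 * 5 ^ (4 * S)) * Real.exp (-t ^ 2 / 128)) := by
        gcongr
        · have h1 : ((insert 0 N).card : ℝ) ≤ N.card + 1 := by
            exact_mod_cast Finset.card_insert_le _ _
          have h2 : (N.card : ℝ) ≤ 5 ^ (14 * r * S * r) := by
            rw [pow_mul, pow_mul]; exact_mod_cast hN
          linarith [hone (14 * r * S * r)]
        · push_cast
          rw [pow_mul]
          have := hone (4 * S)
          rw [pow_mul] at this
          norm_num at this ⊢
          linarith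
    _ ≤ (Real.exp S * Real.exp (2 * (14 * r * S * r : ℕ))) *
          ((Real.exp S * Real.exp (2 * (4 * S : ℕ))) * Real.exp (-t ^ 2 / 128)) := by
        have h2 : (2 : ℝ) ≤ Real.exp S := by linarith [Real.add_one_le_exp (S : ℝ)]
        gcongr
        exacts [hpow5 _, hpow5 _]
    _ = Real.exp (-S) := by
        rw [← Real.exp_add, ← Real.exp_add, ← Real.exp_add, ← Real.exp_add, ht2]
        congr 1
        push_cast
        ring

end Excess

/-! ### From bounded multilinear rank to few rank-one terms -/

section Frames

/-- A subspace of dimension at most `r` has a Parseval frame of `r` vectors of norm at most one. -/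
lemma exists_frame {E : Type*} [NormedAddCommGroup E] [InnerProductSpace ℝ E]
    [FiniteDimensional ℝ E] (U : Submodule ℝ E) {r : ℕ} (hr : Module.finrank ℝ U ≤ r) :
    ∃ q : Fin r → E, (∀ a, ‖q a‖ ≤ 1) ∧ ∀ v ∈ U, v = ∑ a, inner ℝ (q a) v • q a := by
  let b := stdOrthonormalBasis ℝ U
  have hinj := Fin.castLE_injective hr
  -- An orthonormal basis is padded with zero vectors, so that the index type does not depend on the
  -- dimension of U.
  refine ⟨Function.extend (Fin.castLE hr) (fun i => (b i : E)) 0, fun a => ?_, fun v hv => ?_⟩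
  · by_cases ha : ∃ i, Fin.castLE hr i = a
    · obtain ⟨i, rfl⟩ := ha
      rw [hinj.extend_apply]
      exact (b.norm_eq_one i).le
    · rw [Function.extend_apply' _ _ _ ha]; simp
  · have h := congrArg Subtype.val (b.sum_repr' ⟨v, hv⟩)
    rw [Submodule.coe_sum] at h
    refine h.symm.trans (Fintype.sum_of_injective _ hinj _ _ (fun a ha => ?_) fun i => ?_)
    · rw [Function.extend_apply' _ _ _ ha]; simp
    · rw [hinj.extend_apply]; rfl

variable {α β γ : Type*} [Fintype α] [Fintype β] [Fintype γ]

/-- A Tucker decomposition: d is expanded in frames of U and W, and w is the contraction of d with a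
pair of frame vectors. Pairing d with q ⊗ s ⊗ w gives ‖w‖² ≤ ‖d‖‖w‖, whence ‖w‖ ≤ ‖d‖. -/
lemma mem_lowRank_of_mem_submodule {d : EuclideanSpace ℝ (α × β × γ)}
    {U : Submodule ℝ (EuclideanSpace ℝ α)} {W : Submodule ℝ (EuclideanSpace ℝ β)} {r₁ r₂ : ℕ}
    (hU : Module.finrank ℝ U ≤ r₁) (hW : Module.finrank ℝ W ≤ r₂)
    (hdU : ∀ j t, (WithLp.toLp 2 fun i => d (i, j, t)) ∈ U)
    (hdW : ∀ i t, (WithLp.toLp 2 fun j => d (i, j, t)) ∈ W) :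
    d ∈ lowRank (Fin r₁ × Fin r₂) α β γ := by
  obtain ⟨q, hq, hqU⟩ := exists_frame U hU
  obtain ⟨s, hs, hsW⟩ := exists_frame W hW
  let g : Fin r₁ × Fin r₂ → EuclideanSpace ℝ γ := fun m =>
    WithLp.toLp 2 fun t => ∑ i, ∑ j, q m.1 i * s m.2 j * d (i, j, t)
  refine ⟨fun m => q m.1, fun m => s m.2, g, fun m => ⟨hq _, hs _, ?_⟩, ?_⟩
  · have h1 : ‖g m‖ ^ 2 = inner ℝ d (outer (q m.1) (s m.2) (g m)) := by
      rw [EuclideanSpace.real_norm_sq_eq, PiLp.inner_apply, Fintype.sum_prod_type]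
      simp only [Fintype.sum_prod_type, outer_apply]
      rw [Finset.sum_congr rfl fun i _ => Finset.sum_comm, Finset.sum_comm]
      refine Finset.sum_congr rfl fun t _ => ?_
      have : g m t = ∑ i, ∑ j, q m.1 i * s m.2 j * d (i, j, t) := rfl
      rw [sq]
      nth_rewrite 1 [this]
      rw [Finset.sum_mul]
      refine Finset.sum_congr rfl fun i _ => ?_
      rw [Finset.sum_mul]
      refine Finset.sum_congr rfl fun j _ => ?_
      simp
      ring
    have h2 : ‖g m‖ ^ 2 ≤ ‖d‖ * ‖g m‖ := by
      rw [h1]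
      refine (real_inner_le_norm _ _).trans ?_
      rw [norm_outer]
      refine mul_le_mul_of_nonneg_left ?_ (norm_nonneg _)
      calc ‖q m.1‖ * ‖s m.2‖ * ‖g m‖ ≤ 1 * 1 * ‖g m‖ := by
            gcongr
            exacts [hq _, hs _]
        _ = ‖g m‖ := by ring
    rcases (norm_nonneg (g m)).eq_or_lt with h0 | h0
    · rw [← h0]; positivity
    · exact le_of_mul_le_mul_right (by rwa [← sq]) h0
  · ext ⟨i, j, t⟩
    have h1 : ∀ j, d (i, j, t) = ∑ a, (∑ i', q a i' * d (i', j, t)) * q a i := fun j => by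
      have := congrArg (fun v : EuclideanSpace ℝ α => v i) (hqU _ (hdU j t))
      simpa [PiLp.inner_apply, mul_comm] using this
    have h2 : ∀ i', d (i', j, t) = ∑ b, (∑ j', s b j' * d (i', j', t)) * s b j := fun i' => by
      have := congrArg (fun v : EuclideanSpace ℝ β => v j) (hsW _ (hdW i' t))
      simpa [PiLp.inner_apply, mul_comm] using this
    rw [h1 j]
    simp only [WithLp.ofLp_sum, Finset.sum_apply, outer_apply, Fintype.sum_prod_type]
    refine Finset.sum_congr rfl fun a _ => ?_
    rw [Finset.sum_congr rfl fun i' _ => by rw [h2 i', Finset.mul_sum], Finset.sum_comm,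
      Finset.sum_mul]
    refine Finset.sum_congr rfl fun b _ => ?_
    simp only [g, Finset.mul_sum, Finset.sum_mul]
    refine Finset.sum_congr rfl fun i' _ => Finset.sum_congr rfl fun j' _ => ?_
    ring

end Frames

/-! ### Differences of common components -/

section Params

variable {k₁ k₂ ℓ₁ ℓ₂ p₁ p₂ T : ℕ}

/-- The array of differences of two common components. -/
noncomputable def commonDiff (θ : Params ℓ₁ ℓ₂ p₁ p₂ T) (θ' : Params k₁ k₂ p₁ p₂ T) :
    EuclideanSpace ℝ (Fin p₁ × Fin p₂ × Fin T) :=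
  WithLp.toLp 2 fun x => θ.common x.1 x.2.1 x.2.2 - θ'.common x.1 x.2.1 x.2.2

@[simp] lemma commonDiff_apply (θ : Params ℓ₁ ℓ₂ p₁ p₂ T) (θ' : Params k₁ k₂ p₁ p₂ T)
    (x : Fin p₁ × Fin p₂ × Fin T) :
    commonDiff θ θ' x = θ.common x.1 x.2.1 x.2.2 - θ'.common x.1 x.2.1 x.2.2 := rfl

lemma common_mem_span_row (θ : Params ℓ₁ ℓ₂ p₁ p₂ T) (j : Fin p₂) (t : Fin T) :
    (WithLp.toLp 2 fun i => θ.common i j t : EuclideanSpace ℝ (Fin p₁)) ∈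
      Submodule.span ℝ (Set.range fun a => (WithLp.toLp 2 fun i => θ.R i a)) := by
  have : (WithLp.toLp 2 fun i => θ.common i j t : EuclideanSpace ℝ (Fin p₁)) =
      ∑ a, (θ.F t * θ.C.transpose) a j • WithLp.toLp 2 fun i => θ.R i a := by
    ext i
    simp only [Params.common, Matrix.mul_assoc]
    rw [Matrix.mul_apply]
    simp [mul_comm]
  rw [this]
  exact Submodule.sum_mem _ fun a _ => Submodule.smul_mem _ _ (Submodule.subset_span ⟨a, rfl⟩)

lemma common_mem_span_col (θ : Params ℓ₁ ℓ₂ p₁ p₂ T) (i : Fin p₁) (t : Fin T) :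
    (WithLp.toLp 2 fun j => θ.common i j t : EuclideanSpace ℝ (Fin p₂)) ∈
      Submodule.span ℝ (Set.range fun b => (WithLp.toLp 2 fun j => θ.C j b)) := by
  have : (WithLp.toLp 2 fun j => θ.common i j t : EuclideanSpace ℝ (Fin p₂)) =
      ∑ b, (θ.R * θ.F t) i b • WithLp.toLp 2 fun j => θ.C j b := by
    ext j
    simp only [Params.common]
    rw [Matrix.mul_apply]
    simp
  rw [this]
  exact Submodule.sum_mem _ fun a _ => Submodule.smul_mem _ _ (Submodule.subset_span ⟨a, rfl⟩)

lemma finrank_span_sup_le {E : Type*} [NormedAddCommGroup E] [NormedSpace ℝ E]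
    [FiniteDimensional ℝ E] {m n : ℕ}
    (v : Fin m → E) (w : Fin n → E) :
    Module.finrank ℝ ↑(Submodule.span ℝ (Set.range v) ⊔ Submodule.span ℝ (Set.range w)) ≤
      m + n := by
  refine (Submodule.finrank_add_le_finrank_add_finrank _ _).trans ?_
  have h1 : Module.finrank ℝ (Submodule.span ℝ (Set.range v)) ≤ _ := finrank_range_le_card v
  have h2 : Module.finrank ℝ (Submodule.span ℝ (Set.range w)) ≤ _ := finrank_range_le_card w
  simp only [Fintype.card_fin] at h1 h2
  omega

/-- The number of rank-one terms is free of the sample sizes. Fibres of the difference along i lie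
in the sum of the two row-loading spans, fibres along j in the sum of the two column-loading spans.
-/
lemma commonDiff_mem_lowRank (θ : Params ℓ₁ ℓ₂ p₁ p₂ T) (θ' : Params k₁ k₂ p₁ p₂ T) :
    commonDiff θ θ' ∈ lowRank (Fin (ℓ₁ + k₁) × Fin (ℓ₂ + k₂)) (Fin p₁) (Fin p₂) (Fin T) := by
  refine mem_lowRank_of_mem_submodule
    (finrank_span_sup_le (fun a => (WithLp.toLp 2 fun i => θ.R i a))
      (fun a => (WithLp.toLp 2 fun i => θ'.R i a)))
    (finrank_span_sup_le (fun b => (WithLp.toLp 2 fun j => θ.C j b))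
      (fun b => (WithLp.toLp 2 fun j => θ'.C j b)))
    (fun j t => ?_) (fun i t => ?_)
  · exact Submodule.sub_mem _ (Submodule.mem_sup_left (common_mem_span_row θ j t))
      (Submodule.mem_sup_right (common_mem_span_row θ' j t))
  · exact Submodule.sub_mem _ (Submodule.mem_sup_left (common_mem_span_col θ i t))
      (Submodule.mem_sup_right (common_mem_span_col θ' i t))

/-- The distance of a product through `ℓ < k` row factors from one with `k` strong row factors. -/
lemma le_sum_sq_sub_of_lt {ℓ k k' n m T : ℕ} (hℓ : ℓ < k) (R : Matrix (Fin n) (Fin ℓ) ℝ)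
    (H : Fin T → Matrix (Fin ℓ) (Fin m) ℝ) (R₀ : Matrix (Fin n) (Fin k) ℝ)
    (F₀ : Fin T → Matrix (Fin k) (Fin k') ℝ) (C₀ : Matrix (Fin m) (Fin k') ℝ)
    (hn : 0 < n) (hm : 0 < m) (hT : 0 < T)
    (hR : (n : ℝ)⁻¹ • (R₀.transpose * R₀) = 1) (hC : (m : ℝ)⁻¹ • (C₀.transpose * C₀) = 1)
    (hF : (rowMoment F₀).IsDiag) {s : ℝ} (hs : ∀ j, s ≤ rowMoment F₀ j j) :
    (n : ℝ) * m * T * s ≤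
      ∑ t, ∑ j, ∑ i, ((R * H t) i j - (R₀ * F₀ t * C₀.transpose) i j) ^ 2 := by
  have hn' : (0 : ℝ) < n := by exact_mod_cast hn
  have hm' : (0 : ℝ) < m := by exact_mod_cast hm
  have hT' : (0 : ℝ) < T := by exact_mod_cast hT
  -- As ℓ < k, some a = R₀v with v ≠ 0 is orthogonal to the columns of R. Testing with a kills the
  -- competitor R H and leaves only the true component.
  obtain ⟨v, hv, hv0⟩ : ∃ v, (R.transpose * R₀).mulVec v = 0 ∧ v ≠ 0 := by
    have := LinearMap.ker_ne_bot_of_finrank_lt (f := (R.transpose * R₀).mulVecLin) (by simpa)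
    obtain ⟨v, hv, hv0⟩ := Submodule.exists_mem_ne_zero_of_ne_bot this
    exact ⟨v, hv, hv0⟩
  set a : Fin n → ℝ := R₀.mulVec v with ha
  have haR : Matrix.vecMul a R = 0 := by
    rw [← Matrix.mulVec_transpose, ha, Matrix.mulVec_mulVec, hv]
  have hR' : R₀.transpose * R₀ = (n : ℝ) • 1 := by
    rw [← hR, smul_smul, mul_inv_cancel₀ hn'.ne', one_smul]
  have hC' : C₀.transpose * C₀ = (m : ℝ) • 1 := by
    rw [← hC, smul_smul, mul_inv_cancel₀ hm'.ne', one_smul]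
  have hF' : ∑ t, F₀ t * (F₀ t).transpose = (T : ℝ) • rowMoment F₀ := by
    rw [rowMoment, smul_smul, mul_inv_cancel₀ hT'.ne', one_smul]
  have haa : a ⬝ᵥ a = n * (v ⬝ᵥ v) := by
    rw [ha, Matrix.dotProduct_mulVec, ← Matrix.mulVec_transpose, Matrix.mulVec_mulVec, hR',
      Matrix.smul_mulVec, Matrix.one_mulVec, smul_dotProduct, smul_eq_mul]
  have haR₀ : Matrix.vecMul a R₀ = (n : ℝ) • v := by
    rw [← Matrix.mulVec_transpose, ha, Matrix.mulVec_mulVec, hR', Matrix.smul_mulVec,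
      Matrix.one_mulVec]
  have hvv : 0 < v ⬝ᵥ v := by
    have : 0 ≤ v ⬝ᵥ v := Finset.sum_nonneg fun i _ => mul_self_nonneg _
    exact this.lt_of_ne' fun h => hv0 (dotProduct_self_eq_zero.1 h)
  let w : Fin T → Fin m → ℝ := fun t => C₀.mulVec ((F₀ t).transpose.mulVec v)
  have hw : ∀ t j, ∑ i, a i * ((R * H t) i j - (R₀ * F₀ t * C₀.transpose) i j) =
      -(n * w t j) := by
    intro t j
    have h1 : ∑ i, a i * (R * H t) i j = 0 := by
      change (Matrix.vecMul a (R * H t)) j = 0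
      rw [← Matrix.vecMul_vecMul, haR]; simp
    have h2 : ∑ i, a i * (R₀ * F₀ t * C₀.transpose) i j = n * w t j := by
      change (Matrix.vecMul a (R₀ * F₀ t * C₀.transpose)) j = n * w t j
      rw [← Matrix.vecMul_vecMul, ← Matrix.vecMul_vecMul, haR₀, Matrix.smul_vecMul,
        Matrix.smul_vecMul, Matrix.vecMul_transpose, ← Matrix.mulVec_transpose]
      rfl
    simp only [mul_sub, Finset.sum_sub_distrib, h1, h2, zero_sub]
  -- Cauchy–Schwarz with ‖a‖² = n‖v‖². Summed over t and j, the left side becomes the quadratic form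
  -- of the row moment at v, at least s‖v‖² since that matrix is diagonal.
  have hCS : ∀ t j, n * w t j ^ 2 ≤ (v ⬝ᵥ v) *
      ∑ i, ((R * H t) i j - (R₀ * F₀ t * C₀.transpose) i j) ^ 2 := by
    intro t j
    have h1 := Finset.sum_mul_sq_le_sq_mul_sq Finset.univ a
      fun i => (R * H t) i j - (R₀ * F₀ t * C₀.transpose) i j
    rw [hw t j] at h1
    have h2 : ∑ i, a i ^ 2 = n * (v ⬝ᵥ v) := by
      rw [← haa]; simp [dotProduct, sq]
    rw [h2, neg_sq, mul_pow, sq (n : ℝ), mul_assoc, mul_assoc] at h1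
    exact le_of_mul_le_mul_left h1 hn'
  have hww : ∀ t, ∑ j, w t j ^ 2 = m * (v ⬝ᵥ (F₀ t * (F₀ t).transpose).mulVec v) := by
    intro t
    have h1 : ∑ j, w t j ^ 2 = w t ⬝ᵥ w t := by simp [dotProduct, sq]
    rw [h1]
    simp only [w]
    rw [Matrix.dotProduct_mulVec, ← Matrix.mulVec_transpose, Matrix.mulVec_mulVec, hC',
      Matrix.smul_mulVec, Matrix.one_mulVec, smul_dotProduct, smul_eq_mul,
      Matrix.dotProduct_mulVec, ← Matrix.mulVec_transpose, Matrix.mulVec_mulVec,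
      Matrix.transpose_transpose, dotProduct_comm]
  have hsum : ∑ t, ∑ j, w t j ^ 2 = m * T * (v ⬝ᵥ (rowMoment F₀).mulVec v) := by
    simp only [hww]
    rw [← Finset.mul_sum, ← dotProduct_sum, ← Matrix.sum_mulVec, hF', Matrix.smul_mulVec,
      dotProduct_smul, smul_eq_mul, mul_assoc]
  have hquad : s * (v ⬝ᵥ v) ≤ v ⬝ᵥ (rowMoment F₀).mulVec v := by
    rw [dotProduct, dotProduct, Finset.mul_sum]
    refine Finset.sum_le_sum fun j _ => ?_
    have : (rowMoment F₀).mulVec v j = rowMoment F₀ j j * v j := by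
      rw [Matrix.mulVec, dotProduct]
      exact Finset.sum_eq_single j (fun i _ hij => by rw [hF hij.symm, zero_mul]) (by simp)
    rw [this]
    nlinarith [mul_le_mul_of_nonneg_right (hs j) (mul_self_nonneg (v j))]
  have htot : n * ∑ t, ∑ j, w t j ^ 2 ≤ (v ⬝ᵥ v) *
      ∑ t, ∑ j, ∑ i, ((R * H t) i j - (R₀ * F₀ t * C₀.transpose) i j) ^ 2 := by
    simp only [Finset.mul_sum (Finset.univ : Finset (Fin T)), Finset.mul_sum (Finset.univ : Finset (Fin m))]
    exact Finset.sum_le_sum fun t _ => Finset.sum_le_sum fun j _ => hCS t j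
  rw [hsum] at htot
  refine le_of_mul_le_mul_left (le_trans ?_ htot) hvv
  have := mul_le_mul_of_nonneg_left hquad (by positivity : (0 : ℝ) ≤ n * m * T)
  linarith

/-- A parameter with too few row or column factors is far from a parameter with strong factors. -/
lemma le_norm_commonDiff_sq {A : Set (Fin k₁ → ℝ)} {B : Set (Fin k₂ → ℝ)}
    {𝓕 : Set (Matrix (Fin k₁) (Fin k₂) ℝ)} {θ₀ : Params k₁ k₂ p₁ p₂ T}
    (hθ₀ : θ₀ ∈ paramSpace A B 𝓕 p₁ p₂ T) (θ : Params ℓ₁ ℓ₂ p₁ p₂ T) (hℓ : ℓ₁ < k₁ ∨ ℓ₂ < k₂)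
    (hp₁ : 0 < p₁) (hp₂ : 0 < p₂) (hT : 0 < T) {s : ℝ} (hs : ∀ j, s ≤ rowMoment θ₀.F j j)
    (hs' : ∀ j, s ≤ colMoment θ₀.F j j) :
    (p₁ : ℝ) * p₂ * T * s ≤ ‖commonDiff θ θ₀‖ ^ 2 := by
  obtain ⟨-, -, -, hR, hC, hrow, hcol⟩ := hθ₀
  have e : ‖commonDiff θ θ₀‖ ^ 2 =
      ∑ t, ∑ j, ∑ i, (θ.common i j t - θ₀.common i j t) ^ 2 := by
    rw [EuclideanSpace.real_norm_sq_eq]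
    simp only [Fintype.sum_prod_type_right, commonDiff_apply]
  rw [e]
  rcases hℓ with h | h
  · have := le_sum_sq_sub_of_lt h θ.R (fun t => θ.F t * θ.C.transpose) θ₀.R θ₀.F θ₀.C hp₁ hp₂ hT
      hR hC hrow.1 hs
    simpa only [Params.common, Matrix.mul_assoc] using this
  -- The column case is the row case for the transposed model.
  · have hmom : rowMoment (fun t => (θ₀.F t).transpose) = colMoment θ₀.F := by
      simp [rowMoment, colMoment]
    have := le_sum_sq_sub_of_lt h θ.C (fun t => (θ.R * θ.F t).transpose) θ₀.C
      (fun t => (θ₀.F t).transpose) θ₀.R hp₂ hp₁ hT hC hR (hmom ▸ hcol.1) (hmom ▸ hs')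
    rw [mul_comm (p₁ : ℝ)]
    refine this.trans_eq (Finset.sum_congr rfl fun t _ => ?_)
    rw [Finset.sum_comm]
    refine Finset.sum_congr rfl fun j _ => Finset.sum_congr rfl fun i _ => ?_
    have h1 : θ.C * (θ.R * θ.F t).transpose = (θ.R * θ.F t * θ.C.transpose).transpose := by
      rw [Matrix.transpose_mul _ θ.C.transpose, Matrix.transpose_transpose]
    have h2 : θ₀.C * (θ₀.F t).transpose * θ₀.R.transpose =
        (θ₀.R * θ₀.F t * θ₀.C.transpose).transpose := by
      rw [Matrix.transpose_mul, Matrix.transpose_mul, Matrix.transpose_transpose, Matrix.mul_assoc]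
    rw [h1, h2]
    rfl

/-- The common components of parameters in `Θ^{k₁k₂}` are uniformly bounded. -/
lemma exists_abs_common_le {A : Set (Fin k₁ → ℝ)} {B : Set (Fin k₂ → ℝ)}
    {𝓕 : Set (Matrix (Fin k₁) (Fin k₂) ℝ)} (hA : IsCompact A) (hB : IsCompact B)
    (h𝓕 : IsCompact 𝓕) :
    ∃ M : ℝ, ∀ (p₁ p₂ T : ℕ), ∀ θ ∈ paramSpace A B 𝓕 p₁ p₂ T, ∀ i j t, |θ.common i j t| ≤ M := by
  obtain ⟨M, hM⟩ := ((hA.prod (h𝓕.prod hB)).image (f := fun q : (Fin k₁ → ℝ) ×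
    Matrix (Fin k₁) (Fin k₂) ℝ × (Fin k₂ → ℝ) => ∑ b, (∑ a, q.1 a * q.2.1 a b) * q.2.2 b)
    (by fun_prop)).isBounded.exists_norm_le
  refine ⟨M, fun p₁ p₂ T θ hθ i j t => ?_⟩
  obtain ⟨hR, hF, hC, -⟩ := hθ
  have := hM _ ⟨(θ.R i, θ.F t, θ.C j), ⟨hR i, hF t, hC j⟩, rfl⟩
  simpa [Params.common, Matrix.mul_apply] using this

end Params

/-! ### Calculus of events of high probability -/

section HighProb

variable {ι : Type*} {l : Filter ι} {Ω : ι → Type*} [∀ n, MeasurableSpace (Ω n)]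
  {μ : ∀ n, Measure (Ω n)}

/-- Inclusions are needed only eventually and almost surely. `HighProb` is stated through outer
measure, so the events need not be measurable. -/
lemma HighProb.mono_ae {E E' : ∀ n, Set (Ω n)} (h : HighProb l μ E)
    (hE : ∀ᶠ n in l, ∀ᵐ ω ∂(μ n), ω ∈ E n → ω ∈ E' n) : HighProb l μ E' := by
  refine tendsto_of_tendsto_of_tendsto_of_le_of_le' tendsto_const_nhds h
    (Eventually.of_forall fun _ => zero_le) ?_
  filter_upwards [hE] with n hn
  refine measure_mono_ae ?_
  filter_upwards [hn] with ω hω h1 h2 using h1 (hω h2)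

lemma HighProb.forall_mem_finset {α : Type*} {s : Finset α} {E : α → ∀ n, Set (Ω n)}
    (h : ∀ a ∈ s, HighProb l μ (E a)) : HighProb l μ fun n => {ω | ∀ a ∈ s, ω ∈ E a n} := by
  have hsum : Tendsto (fun n => ∑ a ∈ s, μ n (E a n)ᶜ) l (𝓝 0) := by
    simpa using tendsto_finsetSum s h
  refine tendsto_of_tendsto_of_tendsto_of_le_of_le tendsto_const_nhds hsum
    (fun _ => zero_le) fun n => ?_
  refine (measure_mono ?_).trans (measure_biUnion_finset_le s _)
  intro ω hω
  by_contra hcon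
  simp only [Set.mem_iUnion, Set.mem_compl_iff, not_exists, not_not] at hcon
  exact hω hcon

lemma HighProb.inter {E E' : ∀ n, Set (Ω n)} (h : HighProb l μ E) (h' : HighProb l μ E') :
    HighProb l μ fun n => E n ∩ E' n := by
  have hsum : Tendsto (fun n => μ n (E n)ᶜ + μ n (E' n)ᶜ) l (𝓝 0) := by simpa using h.add h'
  refine tendsto_of_tendsto_of_tendsto_of_le_of_le tendsto_const_nhds hsum
    (fun _ => zero_le) fun n => ?_
  simp only [Set.compl_inter]
  exact measure_union_le _ _

lemma HighProb.isBigOInProb {Z : ∀ n, Ω n → ℝ} {a : ι → ℝ} {M : ℝ}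
    (h : HighProb l μ fun n => {ω | |Z n ω| ≤ M * a n}) : IsBigOInProb l μ Z a := by
  intro η hη
  refine ⟨M, ?_⟩
  filter_upwards [(tendsto_order.1 h).2 η hη] with n hn
  refine le_trans (measure_mono fun ω hω => ?_) hn.le
  simpa using hω

end HighProb

/-! ### Consequences at a fixed sample size -/

section Sample

variable {k₁ k₂ ℓ₁ ℓ₂ p₁ p₂ T : ℕ}

/-- For almost every value of the factors the conditional law of the errors is an `IsErrorLaw`, and
its bound does not involve that value; integrating over the factors removes the conditioning. The
rate exp(-S) is relaxed to exp(-T). -/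
lemma IsQuantileModel.measure_not_mem_goodErrors_le {Ω : Type*} [MeasurableSpace Ω]
    {μ : Measure Ω} [IsProbabilityMeasure μ] {τ : ℝ}
    {F₀ : Ω → Fin T → Matrix (Fin k₁) (Fin k₂) ℝ} {ε : Ω → Fin p₁ × Fin p₂ × Fin T → ℝ}
    {f : Fin p₁ × Fin p₂ × Fin T → (Fin T → Matrix (Fin k₁) (Fin k₂) ℝ) → ℝ → ℝ}
    (h : IsQuantileModel μ τ F₀ ε f) (hτ : τ ∈ Set.Ioo (0 : ℝ) 1) {c M D : ℝ} (hc : 0 < c)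
    (hM : 0 ≤ M) (hD : 0 < D)
    (hf : ∀ᵐ F ∂(μ.map F₀), ∀ x, ∀ u ∈ Set.Icc (-M) M, c ≤ f x F u) (hT : 1 ≤ T)
    (κ : Type*) [Fintype κ] :
    μ {ω | ε ω ∈ goodErrors κ (Fin p₁) (Fin p₂) (Fin T) τ c M D}ᶜ ≤
      ENNReal.ofReal (Real.exp (-(T : ℝ))) := by
  have hmeas := (isClosed_goodErrors (κ := κ) (α := Fin p₁) (β := Fin p₂) (γ := Fin T)
    τ c M D).measurableSet.compl
  have hprob : IsProbabilityMeasure (μ.map F₀) :=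
    Measure.isProbabilityMeasure_map h.measurable_factor.aemeasurable
  have h1 : μ {ω | ε ω ∈ goodErrors κ (Fin p₁) (Fin p₂) (Fin T) τ c M D}ᶜ =
      ∫⁻ F, condDistrib ε F₀ μ F (goodErrors κ (Fin p₁) (Fin p₂) (Fin T) τ c M D)ᶜ
        ∂(μ.map F₀) := by
    rw [← Measure.bind_apply hmeas (Kernel.aemeasurable _),
      condDistrib_comp_map h.measurable_factor.aemeasurable h.measurable_error.aemeasurable,
      Measure.map_apply h.measurable_error hmeas]
    rfl
  rw [h1]
  calc _ ≤ ∫⁻ _, ENNReal.ofReal (Real.exp (-(T : ℝ))) ∂(μ.map F₀) := by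
        refine lintegral_mono_ae ?_
        filter_upwards [h.cond_indep, h.cond_density, h.cond_quantile, hf] with F a1 a2 a3 a4
        have hlaw : IsErrorLaw (condDistrib ε F₀ μ F) τ c M fun x => f x F := ⟨a1, a2, a3, a4⟩
        have := measureReal_compl_goodErrors_le (κ := κ) (D := D) hlaw hτ hc hM hD
          (by simp only [Fintype.card_fin]; omega)
        rw [← ofReal_measureReal]
        refine ENNReal.ofReal_le_ofReal (this.trans (Real.exp_le_exp.2 ?_))
        simp only [Fintype.card_fin]
        push_cast
        linarith [Nat.cast_nonneg (α := ℝ) p₁, Nat.cast_nonneg (α := ℝ) p₂]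
    _ = _ := by simp

/-- For good errors, the excess loss of low-rank arrays of norm at least `D` is of order `D²`. -/
lemma le_excess_of_le_norm {α β γ κ : Type*} [Fintype α] [Fintype β] [Fintype γ] [Fintype κ]
    {τ c M D : ℝ} {e : α × β × γ → ℝ} (he : e ∈ goodErrors κ α β γ τ c M D) (hc : 0 < c)
    (hD : 0 < D) (hDS : noiseConst (Fintype.card κ) *
      √(Fintype.card α + Fintype.card β + Fintype.card γ : ℕ) ≤ c / 8 * D)
    {d : EuclideanSpace ℝ (α × β × γ)} (hd : d ∈ lowRank κ α β γ) (hdM : ∀ x, |d x| ≤ M)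
    (hdD : D ≤ ‖d‖) : c / 4 * D ^ 2 ≤ excess τ e d := by
  have hd0 : 0 < ‖d‖ := hD.trans_le hdD
  have hs0 : 0 ≤ D / ‖d‖ := by positivity
  have hs1 : D / ‖d‖ ≤ 1 := (div_le_one hd0).2 hdD
  -- Shrinking d to norm exactly D keeps it low-rank and bounded; by convexity its excess is at most
  -- D/‖d‖ times that of d.
  have h1 := (he _ (smul_mem_lowRank hd (D / ‖d‖)) fun x => by
    rw [PiLp.smul_apply, smul_eq_mul, abs_mul, abs_of_nonneg hs0]
    exact (mul_le_of_le_one_left (abs_nonneg _) hs1).trans (hdM x)).2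
    (by rw [norm_smul, Real.norm_of_nonneg hs0, div_mul_cancel₀ _ hd0.ne'])
  have h2 := excess_smul_le τ e d hs0 hs1
  have h3 := mul_le_mul_of_nonneg_right hDS hD.le
  -- The noise takes c/8 from the quadratic coefficient 3c/8.
  have h4 : c / 4 * D ^ 2 ≤ D / ‖d‖ * excess τ e d := by nlinarith
  have h5 : 0 ≤ excess τ e d := by
    by_contra! h
    have : 0 < c / 4 * D ^ 2 := by positivity
    nlinarith
  exact h4.trans (mul_le_of_le_one_left h5 hs1)

/-- For good errors, low-rank arrays that do not increase the loss decrease it by at most the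
squared noise level. -/
lemma le_excess_of_nonpos {α β γ κ : Type*} [Fintype α] [Fintype β] [Fintype γ] [Fintype κ]
    {τ c M D : ℝ} {e : α × β × γ → ℝ} (he : e ∈ goodErrors κ α β γ τ c M D) (hc : 0 < c)
    (hD : 0 < D) (hDS : noiseConst (Fintype.card κ) *
      √(Fintype.card α + Fintype.card β + Fintype.card γ : ℕ) ≤ c / 8 * D)
    {d : EuclideanSpace ℝ (α × β × γ)} (hd : d ∈ lowRank κ α β γ) (hdM : ∀ x, |d x| ≤ M)
    (hd0 : excess τ e d ≤ 0) : -(c / 8 * D ^ 2) ≤ excess τ e d := by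
  -- Beyond norm D the excess would be positive; within it, the linear noise bound is at most (c/8)D
  -- · D.
  have hdD : ‖d‖ ≤ D := by
    by_contra! h
    have := le_excess_of_le_norm he hc hD hDS hd hdM h.le
    have : 0 < c / 4 * D ^ 2 := by positivity
    linarith
  refine le_trans ?_ (he d hd hdM).1
  rw [neg_le_neg_iff, sq, ← mul_assoc]
  exact mul_le_mul hDS hdD (norm_nonneg _) (by positivity)

lemma avgLoss_sub_avgLoss {τ : ℝ} {X : Fin p₁ → Fin p₂ → Fin T → ℝ}
    {e : Fin p₁ × Fin p₂ × Fin T → ℝ} {θ₀ : Params k₁ k₂ p₁ p₂ T}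
    (hX : ∀ i j t, X i j t = θ₀.common i j t + e (i, j, t)) (θ : Params ℓ₁ ℓ₂ p₁ p₂ T) :
    avgLoss τ X θ - avgLoss τ X θ₀ =
      ((p₁ : ℝ) * p₂ * T)⁻¹ * excess τ e (commonDiff θ θ₀) := by
  rw [avgLoss, avgLoss, ← mul_sub, excess]
  congr 1
  simp only [Fintype.sum_prod_type, ← Finset.sum_sub_distrib, hX, commonDiff_apply]
  refine Finset.sum_congr rfl fun i _ => Finset.sum_congr rfl fun j _ =>
    Finset.sum_congr rfl fun t _ => ?_
  congr 2 <;> ring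

lemma avgLoss_congr {τ : ℝ} {X : Fin p₁ → Fin p₂ → Fin T → ℝ} {θ : Params ℓ₁ ℓ₂ p₁ p₂ T}
    {θ' : Params k₁ k₂ p₁ p₂ T} (h : θ.common = θ'.common) : avgLoss τ X θ = avgLoss τ X θ' := by
  simp only [avgLoss, h]

lemma rate_sq_le (p₁ p₂ T : ℕ) :
    rate p₁ p₂ T ^ 2 ≤ p₁ * p₂ ∧ rate p₁ p₂ T ^ 2 ≤ p₂ * T ∧ rate p₁ p₂ T ^ 2 ≤ p₁ * T := by
  have h0 : 0 ≤ rate p₁ p₂ T := by unfold rate; positivity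
  refine ⟨?_, ?_, ?_⟩ <;> refine (Real.le_sqrt h0 (by positivity)).1 ?_
  · exact min_le_left _ _
  · exact (min_le_right _ _).trans (min_le_left _ _)
  · exact (min_le_right _ _).trans (min_le_right _ _)

lemma rate_pos {p₁ p₂ T : ℕ} (hp₁ : 0 < p₁) (hp₂ : 0 < p₂) (hT : 0 < T) : 0 < rate p₁ p₂ T := by
  unfold rate; positivity

/-- The ratio of the sum of the dimensions to the sample size is at most `3 L⁻²`. -/
lemma sum_div_prod_le_rate {p₁ p₂ T : ℕ} (hp₁ : 0 < p₁) (hp₂ : 0 < p₂) (hT : 0 < T) :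
    ((p₁ : ℝ) * p₂ * T)⁻¹ * (p₁ + p₂ + T) ≤ 3 * (rate p₁ p₂ T ^ 2)⁻¹ := by
  have hr := pow_pos (rate_pos hp₁ hp₂ hT) 2
  obtain ⟨h1, h2, h3⟩ := rate_sq_le p₁ p₂ T
  have a1 : (0 : ℝ) < p₁ := by exact_mod_cast hp₁
  have a2 : (0 : ℝ) < p₂ := by exact_mod_cast hp₂
  have a3 : (0 : ℝ) < T := by exact_mod_cast hT
  -- Dividing S by N gives 1/(p₂T) + 1/(p₁T) + 1/(p₁p₂), each term at most L⁻².
  rw [inv_mul_eq_div, ← div_eq_mul_inv, div_le_div_iff₀ (by positivity) hr]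
  nlinarith [mul_le_mul_of_nonneg_left h1 a3.le, mul_le_mul_of_nonneg_left h2 a1.le,
    mul_le_mul_of_nonneg_left h3 a2.le]

end Sample

/-! ### Limits along growing sample sizes -/

section Asymptotics

variable {ι : Type*} {l : Filter ι} {p₁ p₂ T : ι → ℕ}

/-- The sum of the dimensions is of smaller order than the sample size. -/
lemma eventually_sum_le_mul_prod (hp₁ : Tendsto p₁ l atTop) (hp₂ : Tendsto p₂ l atTop)
    (hT : Tendsto T l atTop) {η : ℝ} (hη : 0 < η) :
    ∀ᶠ n in l, ((p₁ n + p₂ n + T n : ℕ) : ℝ) ≤ η * ((p₁ n : ℝ) * p₂ n * T n) := by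
  obtain ⟨m, hm⟩ := exists_nat_ge (3 / η)
  filter_upwards [hp₁.eventually_ge_atTop (m + 1), hp₂.eventually_ge_atTop (m + 1),
    hT.eventually_ge_atTop (m + 1)] with n h1 h2 h3
  have b1 : ((m : ℝ) + 1) ≤ p₁ n := by exact_mod_cast h1
  have b2 : ((m : ℝ) + 1) ≤ p₂ n := by exact_mod_cast h2
  have b3 : ((m : ℝ) + 1) ≤ T n := by exact_mod_cast h3
  have hm0 : (0 : ℝ) ≤ m := Nat.cast_nonneg m
  have hm3 : 3 ≤ η * (m + 1) := by
    rw [div_le_iff₀ hη] at hm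
    nlinarith
  have key : ∀ x y z : ℝ, m + 1 ≤ x → m + 1 ≤ y → m + 1 ≤ z → 3 * x ≤ η * (x * y * z) := by
    intro x y z hx hy hz
    have hyz : (m : ℝ) + 1 ≤ y * z := by nlinarith
    calc 3 * x ≤ η * (m + 1) * x := mul_le_mul_of_nonneg_right hm3 (by linarith)
      _ ≤ η * (y * z) * x :=
          mul_le_mul_of_nonneg_right (mul_le_mul_of_nonneg_left hyz hη.le) (by linarith)
      _ = _ := by ring
  have c1 := key _ _ _ b1 b2 b3
  have c2 := key _ _ _ b2 b1 b3
  have c3 := key _ _ _ b3 b1 b2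
  push_cast
  linarith

end Asymptotics

section Asymptotics

variable {ι : Type*} {l : Filter ι} {p₁ p₂ T : ι → ℕ} {Ω : ι → Type*} [∀ n, MeasurableSpace (Ω n)]
  {μ : ∀ n, Measure (Ω n)} [∀ n, IsProbabilityMeasure (μ n)] {τ : ℝ} {k₁ k₂ : ℕ}
  {F₀ : ∀ n, Ω n → Fin (T n) → Matrix (Fin k₁) (Fin k₂) ℝ}
  {ε : ∀ n, Ω n → Fin (p₁ n) × Fin (p₂ n) × Fin (T n) → ℝ}
  {f : ∀ n, Fin (p₁ n) × Fin (p₂ n) × Fin (T n) →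
    (Fin (T n) → Matrix (Fin k₁) (Fin k₂) ℝ) → ℝ → ℝ}

lemma highProb_goodErrors (hT : Tendsto T l atTop) (hτ : τ ∈ Set.Ioo (0 : ℝ) 1)
    (hmodel : ∀ᶠ n in l, IsQuantileModel (μ n) τ (F₀ n) (ε n) (f n)) {c M : ℝ} (hc : 0 < c)
    (hM : 0 ≤ M)
    (hf : ∀ᶠ n in l, ∀ᵐ F ∂((μ n).map (F₀ n)), ∀ x, ∀ u ∈ Set.Icc (-M) M, c ≤ f n x F u)
    {D : ι → ℝ} (hD : ∀ᶠ n in l, 0 < D n) (κ : Type*) [Fintype κ] :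
    HighProb l μ fun n =>
      {ω | ε n ω ∈ goodErrors κ (Fin (p₁ n)) (Fin (p₂ n)) (Fin (T n)) τ c M (D n)} := by
  have hlim : Tendsto (fun n => ENNReal.ofReal (Real.exp (-(T n : ℝ)))) l (𝓝 0) := by
    rw [← ENNReal.ofReal_zero]
    exact ENNReal.tendsto_ofReal (Real.tendsto_exp_neg_atTop_nhds_zero.comp
      (tendsto_natCast_atTop_atTop.comp hT))
  refine tendsto_of_tendsto_of_tendsto_of_le_of_le' tendsto_const_nhds hlim
    (Eventually.of_forall fun _ => zero_le) ?_
  filter_upwards [hmodel, hf, hD, hT.eventually_ge_atTop 1] with n h1 h2 h3 h4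
  exact h1.measure_not_mem_goodErrors_le hτ hc hM h3 h2 h4 κ

variable {θ₀ : ∀ n, Ω n → Params k₁ k₂ (p₁ n) (p₂ n) (T n)}
  {X : ∀ n, Ω n → Fin (p₁ n) → Fin (p₂ n) → Fin (T n) → ℝ} {ℓ₁ ℓ₂ : ℕ}
  {θ : ∀ n, Ω n → Params ℓ₁ ℓ₂ (p₁ n) (p₂ n) (T n)}

/-- A bounded parameter that does not increase the loss decreases it by at most `O_p(L⁻²)`. -/
lemma exists_highProb_le_avgLoss_sub (hp₁ : Tendsto p₁ l atTop) (hp₂ : Tendsto p₂ l atTop)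
    (hT : Tendsto T l atTop) (hτ : τ ∈ Set.Ioo (0 : ℝ) 1)
    (hmodel : ∀ᶠ n in l, IsQuantileModel (μ n) τ (F₀ n) (ε n) (f n)) {c M : ℝ} (hc : 0 < c)
    (hM : 0 ≤ M)
    (hf : ∀ᶠ n in l, ∀ᵐ F ∂((μ n).map (F₀ n)), ∀ x, ∀ u ∈ Set.Icc (-M) M, c ≤ f n x F u)
    (hX : ∀ n ω i j t, X n ω i j t = (θ₀ n ω).common i j t + ε n ω (i, j, t))
    (hbdd : ∀ᶠ n in l, ∀ᵐ ω ∂(μ n), ∀ x, |commonDiff (θ n ω) (θ₀ n ω) x| ≤ M)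
    (hle : ∀ᶠ n in l, ∀ᵐ ω ∂(μ n), avgLoss τ (X n ω) (θ n ω) ≤ avgLoss τ (X n ω) (θ₀ n ω)) :
    ∃ b : ℝ, HighProb l μ fun n => {ω | -(b * (rate (p₁ n) (p₂ n) (T n) ^ 2)⁻¹) ≤
      avgLoss τ (X n ω) (θ n ω) - avgLoss τ (X n ω) (θ₀ n ω)} := by
  let K := noiseConst (Fintype.card (Fin (ℓ₁ + k₁) × Fin (ℓ₂ + k₂)))
  have hK : 0 < K := noiseConst_pos _
  -- The radius at which K√S = (c/8)D. Then (c/8)D² = 8K²S/c, and S/N ≤ 3L⁻² gives the constant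
  -- 24K²/c.
  let D : ι → ℝ := fun n => 8 * K / c * √(p₁ n + p₂ n + T n : ℕ)
  have hD : ∀ᶠ n in l, 0 < D n := by
    filter_upwards [hT.eventually_ge_atTop 1] with n hn
    have : (0 : ℝ) < (p₁ n + p₂ n + T n : ℕ) := by exact_mod_cast (by omega)
    positivity
  refine ⟨24 * K ^ 2 / c, (highProb_goodErrors hT hτ hmodel hc hM hf hD
    (Fin (ℓ₁ + k₁) × Fin (ℓ₂ + k₂))).mono_ae ?_⟩
  filter_upwards [hbdd, hle, hD, hp₁.eventually_gt_atTop 0, hp₂.eventually_gt_atTop 0,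
    hT.eventually_gt_atTop 0] with n h1 h2 h3 g1 g2 g3
  filter_upwards [h1, h2] with ω h1 h2 hgood
  have a1 : (0 : ℝ) < p₁ n := by exact_mod_cast g1
  have a2 : (0 : ℝ) < p₂ n := by exact_mod_cast g2
  have a3 : (0 : ℝ) < T n := by exact_mod_cast g3
  have hN : 0 < ((p₁ n : ℝ) * p₂ n * T n)⁻¹ := by positivity
  have e := avgLoss_sub_avgLoss (hX n ω) (τ := τ) (θ n ω)
  have hneg : excess τ (ε n ω) (commonDiff (θ n ω) (θ₀ n ω)) ≤ 0 := by
    have : ((p₁ n : ℝ) * p₂ n * T n)⁻¹ * excess τ (ε n ω) (commonDiff (θ n ω) (θ₀ n ω)) ≤ 0 := by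
      rw [← e]; linarith
    exact nonpos_of_mul_nonpos_right this hN
  have hlow := le_excess_of_nonpos hgood hc h3 (by
    simp only [Fintype.card_fin, D, K]
    exact le_of_eq (by field_simp)) (commonDiff_mem_lowRank _ _) h1 hneg
  have hD2 : c / 8 * D n ^ 2 = 8 * K ^ 2 / c * (p₁ n + p₂ n + T n) := by
    simp only [D, mul_pow]
    rw [Real.sq_sqrt (by positivity)]
    push_cast
    field_simp
  rw [hD2] at hlow
  rw [e]
  have h5 := mul_le_mul_of_nonneg_left hlow hN.le
  have h6 := mul_le_mul_of_nonneg_left (sum_div_prod_le_rate g1 g2 g3)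
    (by positivity : 0 ≤ 8 * K ^ 2 / c)
  refine le_trans ?_ h5
  rw [mul_neg, neg_le_neg_iff]
  calc _ = 8 * K ^ 2 / c * (((p₁ n : ℝ) * p₂ n * T n)⁻¹ * (p₁ n + p₂ n + T n)) := by ring
    _ ≤ _ := h6
    _ = _ := by ring

/-- A bounded parameter that is far from the truth increases the loss by a constant. -/
lemma highProb_lt_avgLoss_sub (hp₁ : Tendsto p₁ l atTop) (hp₂ : Tendsto p₂ l atTop)
    (hT : Tendsto T l atTop) (hτ : τ ∈ Set.Ioo (0 : ℝ) 1)
    (hmodel : ∀ᶠ n in l, IsQuantileModel (μ n) τ (F₀ n) (ε n) (f n)) {c M : ℝ} (hc : 0 < c)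
    (hM : 0 ≤ M)
    (hf : ∀ᶠ n in l, ∀ᵐ F ∂((μ n).map (F₀ n)), ∀ x, ∀ u ∈ Set.Icc (-M) M, c ≤ f n x F u)
    (hX : ∀ n ω i j t, X n ω i j t = (θ₀ n ω).common i j t + ε n ω (i, j, t))
    (hbdd : ∀ᶠ n in l, ∀ᵐ ω ∂(μ n), ∀ x, |commonDiff (θ n ω) (θ₀ n ω) x| ≤ M)
    {s : ℝ} (hs : 0 < s)
    (hfar : HighProb l μ fun n =>
      {ω | (p₁ n : ℝ) * p₂ n * T n * s ≤ ‖commonDiff (θ n ω) (θ₀ n ω)‖ ^ 2}) :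
    HighProb l μ fun n => {ω | c / 8 * s <
      avgLoss τ (X n ω) (θ n ω) - avgLoss τ (X n ω) (θ₀ n ω)} := by
  let K := noiseConst (Fintype.card (Fin (ℓ₁ + k₁) × Fin (ℓ₂ + k₂)))
  have hK : 0 < K := noiseConst_pos _
  -- D is the guaranteed distance from the truth. The noise condition K√S ≤ (c/8)D becomes S ≤
  -- (c²s/64K²)N, which holds eventually.
  let D : ι → ℝ := fun n => √((p₁ n : ℝ) * p₂ n * T n * s)
  have hD : ∀ᶠ n in l, 0 < D n := by
    filter_upwards [hp₁.eventually_gt_atTop 0, hp₂.eventually_gt_atTop 0,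
      hT.eventually_gt_atTop 0] with n g1 g2 g3
    have a1 : (0 : ℝ) < p₁ n := by exact_mod_cast g1
    have a2 : (0 : ℝ) < p₂ n := by exact_mod_cast g2
    have a3 : (0 : ℝ) < T n := by exact_mod_cast g3
    positivity
  refine ((highProb_goodErrors hT hτ hmodel hc hM hf hD
    (Fin (ℓ₁ + k₁) × Fin (ℓ₂ + k₂))).inter hfar).mono_ae ?_
  filter_upwards [hbdd, hD, hp₁.eventually_gt_atTop 0, hp₂.eventually_gt_atTop 0,
    hT.eventually_gt_atTop 0, eventually_sum_le_mul_prod hp₁ hp₂ hT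
    (by positivity : 0 < c ^ 2 * s / (64 * K ^ 2))] with n h1 h3 g1 g2 g3 hS
  filter_upwards [h1] with ω h1 ⟨hgood, hfar⟩
  have a1 : (0 : ℝ) < p₁ n := by exact_mod_cast g1
  have a2 : (0 : ℝ) < p₂ n := by exact_mod_cast g2
  have a3 : (0 : ℝ) < T n := by exact_mod_cast g3
  have hlow := le_excess_of_le_norm hgood hc h3 (by
    simp only [Fintype.card_fin]
    refine (pow_le_pow_iff_left₀ (by positivity) (by positivity) two_ne_zero).1 ?_
    simp only [D, mul_pow]
    rw [Real.sq_sqrt (by positivity), Real.sq_sqrt (by positivity)]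
    refine (mul_le_mul_of_nonneg_left hS (sq_nonneg _)).trans (le_of_eq ?_)
    simp only [K]
    have := noiseConst_pos (Fintype.card (Fin (ℓ₁ + k₁) × Fin (ℓ₂ + k₂)))
    field_simp
    ring) (commonDiff_mem_lowRank _ _) h1 (Real.sqrt_le_iff.2 ⟨norm_nonneg _, hfar⟩)
  rw [avgLoss_sub_avgLoss (hX n ω) (θ n ω)]
  have hN : 0 < ((p₁ n : ℝ) * p₂ n * T n) := by positivity
  have h5 := mul_le_mul_of_nonneg_left hlow (inv_pos.2 hN).le
  refine lt_of_lt_of_le ?_ h5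
  simp only [D]
  rw [Real.sq_sqrt (by positivity)]
  have : ((p₁ n : ℝ) * p₂ n * T n)⁻¹ * (c / 4 * ((p₁ n : ℝ) * p₂ n * T n * s)) = c / 4 * s := by
    field_simp
  rw [this]
  nlinarith [mul_pos hc hs]

end Asymptotics

/-! ### Uniform bounds, the information criterion and the theorem -/

/-- The common components are bounded uniformly over a finite range of factor numbers. -/
lemma exists_forall_abs_common_le {A : ∀ ℓ₁ : ℕ, Set (Fin ℓ₁ → ℝ)}
    {B : ∀ ℓ₂ : ℕ, Set (Fin ℓ₂ → ℝ)} {𝓕 : ∀ ℓ₁ ℓ₂ : ℕ, Set (Matrix (Fin ℓ₁) (Fin ℓ₂) ℝ)}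
    (hA : ∀ ℓ₁, IsCompact (A ℓ₁)) (hB : ∀ ℓ₂, IsCompact (B ℓ₂))
    (h𝓕 : ∀ ℓ₁ ℓ₂, IsCompact (𝓕 ℓ₁ ℓ₂)) (s : Finset (ℕ × ℕ)) :
    ∃ M : ℝ, 0 ≤ M ∧ ∀ q ∈ s, ∀ (p₁ p₂ T : ℕ),
      ∀ θ ∈ paramSpace (A q.1) (B q.2) (𝓕 q.1 q.2) p₁ p₂ T, ∀ i j t, |θ.common i j t| ≤ M := by
  choose M hM using fun q : ℕ × ℕ => exists_abs_common_le (hA q.1) (hB q.2) (h𝓕 q.1 q.2)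
  refine ⟨∑ q ∈ s, |M q|, by positivity, fun q hq p₁ p₂ T θ hθ i j t => ?_⟩
  exact (hM q _ _ _ θ hθ i j t).trans ((le_abs_self _).trans
    (Finset.single_le_sum (f := fun q => |M q|) (fun _ _ => abs_nonneg _) hq))

/-- A minimizer of the information criterion is the true pair as soon as underfitting costs more
than the total penalty and overfitting gains less than one penalty unit. -/
lemma IsICMinimizer.eq {V : ℕ → ℕ → ℝ} {c pen : ℝ} {k₁ k₂ K₁ K₂ : ℕ} {k : ℕ × ℕ}
    (h : IsICMinimizer V pen K₁ K₂ k) (hk₁ : k₁ ∈ Finset.Icc 1 K₁) (hk₂ : k₂ ∈ Finset.Icc 1 K₂)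
    (hpen : 0 < pen) (hpenc : ((k₁ : ℝ) + k₂) * pen < c)
    (hunder : ∀ ℓ₁ ∈ Finset.Icc 1 K₁, ∀ ℓ₂ ∈ Finset.Icc 1 K₂, (ℓ₁ < k₁ ∨ ℓ₂ < k₂) →
      c < V ℓ₁ ℓ₂ - V k₁ k₂)
    (hover : ∀ ℓ₁ ∈ Finset.Icc k₁ K₁, ∀ ℓ₂ ∈ Finset.Icc k₂ K₂, -pen < V ℓ₁ ℓ₂ - V k₁ k₂) :
    k = (k₁, k₂) := by
  obtain ⟨h1, h2, hmin⟩ := h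
  have hm := hmin k₁ hk₁ k₂ hk₂
  by_cases hlt : k.1 < k₁ ∨ k.2 < k₂
  · have := hunder _ h1 _ h2 hlt
    have : 0 ≤ ((k.1 : ℝ) + k.2) * pen := by positivity
    linarith
  · push Not at hlt
    have ho := hover k.1 (Finset.mem_Icc.2 ⟨hlt.1, (Finset.mem_Icc.1 h1).2⟩) k.2
      (Finset.mem_Icc.2 ⟨hlt.2, (Finset.mem_Icc.1 h2).2⟩)
    by_contra hne
    have hsum : k₁ + k₂ + 1 ≤ k.1 + k.2 := by
      by_contra hcon
      exact hne (Prod.ext (by dsimp only; omega) (by dsimp only; omega))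
    have hsum' : (k₁ : ℝ) + k₂ + 1 ≤ k.1 + k.2 := by exact_mod_cast hsum
    nlinarith

end MQF

theorem theorem4p2
    {ι : Type*} (l : Filter ι)
    -- the sample sizes, all tending to infinity
    (p₁ p₂ T : ι → ℕ)
    (hp₁ : Tendsto p₁ l atTop) (hp₂ : Tendsto p₂ l atTop) (hT : Tendsto T l atTop)
    {Ω : ι → Type*} [∀ n, MeasurableSpace (Ω n)]
    (μ : ∀ n, Measure (Ω n)) [∀ n, IsProbabilityMeasure (μ n)]
    -- the quantile level, the true numbers of factors and the search range
    (τ : ℝ) (hτ : τ ∈ Set.Ioo (0 : ℝ) 1)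
    (k₁ k₂ K₁ K₂ : ℕ) (hk₁ : 1 ≤ k₁) (hk₂ : 1 ≤ k₂) (hK₁ : k₁ ≤ K₁) (hK₂ : k₂ ≤ K₂)
    -- the compact sets containing loadings and factor matrices, for each pair of dimensions
    (A : ∀ ℓ₁ : ℕ, Set (Fin ℓ₁ → ℝ)) (B : ∀ ℓ₂ : ℕ, Set (Fin ℓ₂ → ℝ))
    (𝓕 : ∀ ℓ₁ ℓ₂ : ℕ, Set (Matrix (Fin ℓ₁) (Fin ℓ₂) ℝ))
    (hA : ∀ ℓ₁, IsCompact (A ℓ₁)) (hB : ∀ ℓ₂, IsCompact (B ℓ₂))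
    (h𝓕 : ∀ ℓ₁ ℓ₂, IsCompact (𝓕 ℓ₁ ℓ₂))
    -- the true loadings and factors, the errors and their conditional densities
    (R₀ : ∀ n, Matrix (Fin (p₁ n)) (Fin k₁) ℝ) (C₀ : ∀ n, Matrix (Fin (p₂ n)) (Fin k₂) ℝ)
    (F₀ : ∀ n, Ω n → Fin (T n) → Matrix (Fin k₁) (Fin k₂) ℝ)
    (ε : ∀ n, Ω n → Fin (p₁ n) × Fin (p₂ n) × Fin (T n) → ℝ)
    (f : ∀ n, Fin (p₁ n) × Fin (p₂ n) × Fin (T n) →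
      (Fin (T n) → Matrix (Fin k₁) (Fin k₂) ℝ) → ℝ → ℝ)
    (θ₀ : ∀ n, Ω n → MQF.Params k₁ k₂ (p₁ n) (p₂ n) (T n))
    (hθ₀ : ∀ n ω, θ₀ n ω = ⟨R₀ n, F₀ n ω, C₀ n⟩)
    (hmodel : ∀ᶠ n in l, MQF.IsQuantileModel (μ n) τ (F₀ n) (ε n) (f n))
    -- the conditional densities are bounded below on compact sets, uniformly
    (hf : ∀ S : Set ℝ, IsCompact S → ∃ c > 0, ∀ᶠ n in l,
      ∀ᵐ F ∂((μ n).map (F₀ n)), ∀ x, ∀ u ∈ S, c ≤ f n x F u)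
    -- the true parameter lies in its parameter space, and the factors are strong
    (hmem : ∀ᶠ n in l, ∀ᵐ ω ∂(μ n),
      θ₀ n ω ∈ MQF.paramSpace (A k₁) (B k₂) (𝓕 k₁ k₂) (p₁ n) (p₂ n) (T n))
    (σ : Fin k₁ → ℝ) (hσ : ∀ j, 0 < σ j)
    (hσlim : ∀ j, MQF.ConvergesInProb l μ (fun n ω => MQF.rowMoment (F₀ n ω) j j) (σ j))
    (σ' : Fin k₂ → ℝ) (hσ' : ∀ j, 0 < σ' j)
    (hσ'lim : ∀ j, MQF.ConvergesInProb l μ (fun n ω => MQF.colMoment (F₀ n ω) j j) (σ' j))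
    -- the larger models of the search range contain the true common components
    (hnest : ∀ ℓ₁ ∈ Finset.Icc k₁ K₁, ∀ ℓ₂ ∈ Finset.Icc k₂ K₂, ∀ᶠ n in l, ∀ᵐ ω ∂(μ n),
      ∃ θ ∈ MQF.paramSpace (A ℓ₁) (B ℓ₂) (𝓕 ℓ₁ ℓ₂) (p₁ n) (p₂ n) (T n),
        θ.common = (θ₀ n ω).common)
    -- the data
    (X : ∀ n, Ω n → Fin (p₁ n) → Fin (p₂ n) → Fin (T n) → ℝ)
    (hX : ∀ n ω i j t, X n ω i j t = (θ₀ n ω).common i j t + ε n ω (i, j, t))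
    -- the check-loss estimators with `ℓ₁` row and `ℓ₂` column factors
    (θhat : ∀ n (ℓ₁ ℓ₂ : ℕ), Ω n → MQF.Params ℓ₁ ℓ₂ (p₁ n) (p₂ n) (T n))
    (hθhat : ∀ ℓ₁ ∈ Finset.Icc 1 K₁, ∀ ℓ₂ ∈ Finset.Icc 1 K₂, ∀ᶠ n in l, ∀ᵐ ω ∂(μ n),
      MQF.IsEstimator τ (X n ω)
        (MQF.paramSpace (A ℓ₁) (B ℓ₂) (𝓕 ℓ₁ ℓ₂) (p₁ n) (p₂ n) (T n)) (θhat n ℓ₁ ℓ₂ ω))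
    -- the penalty
    (pen : ι → ℝ) (hpen : Tendsto pen l (𝓝 0))
    (hpenL : Tendsto (fun n => pen n * MQF.rate (p₁ n) (p₂ n) (T n) ^ 2) l atTop)
    -- the information-criterion estimator of the numbers of factors
    (khat : ∀ n, Ω n → ℕ × ℕ)
    (hkhat : ∀ᶠ n in l, ∀ᵐ ω ∂(μ n),
      MQF.IsICMinimizer (fun ℓ₁ ℓ₂ => MQF.avgLoss τ (X n ω) (θhat n ℓ₁ ℓ₂ ω)) (pen n) K₁ K₂
        (khat n ω)) :
    -- underfitting in either dimension raises the loss by a positive constant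
    (∃ c > 0, ∀ ℓ₁ ∈ Finset.Icc 1 K₁, ∀ ℓ₂ ∈ Finset.Icc 1 K₂, (ℓ₁ < k₁ ∨ ℓ₂ < k₂) →
      MQF.HighProb l μ fun n => {ω | c < MQF.avgLoss τ (X n ω) (θhat n ℓ₁ ℓ₂ ω) -
        MQF.avgLoss τ (X n ω) (θhat n k₁ k₂ ω)}) ∧
    -- overfitting changes the loss by `O_p(L⁻²)`
    (∀ ℓ₁ ∈ Finset.Icc k₁ K₁, ∀ ℓ₂ ∈ Finset.Icc k₂ K₂,
      MQF.IsBigOInProb l μ (fun n ω => MQF.avgLoss τ (X n ω) (θhat n ℓ₁ ℓ₂ ω) -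
        MQF.avgLoss τ (X n ω) (θhat n k₁ k₂ ω))
        (fun n => (MQF.rate (p₁ n) (p₂ n) (T n) ^ 2)⁻¹)) ∧
    -- consistency
    MQF.HighProb l μ (fun n => {ω | khat n ω = (k₁, k₂)}) := by
  have hk₁' : k₁ ∈ Finset.Icc 1 K₁ := Finset.mem_Icc.2 ⟨hk₁, hK₁⟩
  have hk₂' : k₂ ∈ Finset.Icc 1 K₂ := Finset.mem_Icc.2 ⟨hk₂, hK₂⟩
  have hsub₁ : ∀ ℓ₁ ∈ Finset.Icc k₁ K₁, ℓ₁ ∈ Finset.Icc 1 K₁ := fun ℓ h =>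
    Finset.Icc_subset_Icc_left hk₁ h
  have hsub₂ : ∀ ℓ₂ ∈ Finset.Icc k₂ K₂, ℓ₂ ∈ Finset.Icc 1 K₂ := fun ℓ h =>
    Finset.Icc_subset_Icc_left hk₂ h
  -- a uniform bound on the differences of common components
  obtain ⟨M₀, hM₀, hM⟩ := MQF.exists_forall_abs_common_le hA hB h𝓕
    (Finset.Icc 1 K₁ ×ˢ Finset.Icc 1 K₂)
  have hbdd : ∀ ℓ₁ ∈ Finset.Icc 1 K₁, ∀ ℓ₂ ∈ Finset.Icc 1 K₂, ∀ᶠ n in l, ∀ᵐ ω ∂(μ n),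
      ∀ x, |MQF.commonDiff (θhat n ℓ₁ ℓ₂ ω) (θ₀ n ω) x| ≤ 2 * M₀ := by
    intro ℓ₁ h₁ ℓ₂ h₂
    filter_upwards [hθhat ℓ₁ h₁ ℓ₂ h₂, hmem] with n hn hn'
    filter_upwards [hn, hn'] with ω hω hω' x
    have b₁ := hM (ℓ₁, ℓ₂) (Finset.mk_mem_product h₁ h₂) _ _ _ _ hω.1 x.1 x.2.1 x.2.2
    have b₂ := hM (k₁, k₂) (Finset.mk_mem_product hk₁' hk₂') _ _ _ _ hω' x.1 x.2.1 x.2.2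
    exact (abs_sub _ _).trans (by linarith)
  -- One interval contains every difference array in the search range, so one density bound c serves
  -- all models.
  obtain ⟨c, hc, hfc⟩ := hf (Set.Icc (-(2 * M₀)) (2 * M₀)) isCompact_Icc
  have hM2 : 0 ≤ 2 * M₀ := by positivity
  -- overfitted estimators do not increase the loss
  have hle : ∀ ℓ₁ ∈ Finset.Icc k₁ K₁, ∀ ℓ₂ ∈ Finset.Icc k₂ K₂, ∀ᶠ n in l, ∀ᵐ ω ∂(μ n),
      MQF.avgLoss τ (X n ω) (θhat n ℓ₁ ℓ₂ ω) ≤ MQF.avgLoss τ (X n ω) (θ₀ n ω) := by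
    intro ℓ₁ h₁ ℓ₂ h₂
    filter_upwards [hθhat ℓ₁ (hsub₁ _ h₁) ℓ₂ (hsub₂ _ h₂), hnest ℓ₁ h₁ ℓ₂ h₂] with n hn hn'
    filter_upwards [hn, hn'] with ω hω ⟨θ, hθ, hcom⟩
    exact (hω.2 θ hθ).trans_eq (MQF.avgLoss_congr hcom)
  have hlek := hle k₁ (Finset.mem_Icc.2 ⟨le_rfl, hK₁⟩) k₂ (Finset.mem_Icc.2 ⟨le_rfl, hK₂⟩)
  have hlow : ∀ ℓ₁ ∈ Finset.Icc k₁ K₁, ∀ ℓ₂ ∈ Finset.Icc k₂ K₂, ∃ b : ℝ,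
      MQF.HighProb l μ fun n => {ω | -(b * (MQF.rate (p₁ n) (p₂ n) (T n) ^ 2)⁻¹) ≤
        MQF.avgLoss τ (X n ω) (θhat n ℓ₁ ℓ₂ ω) - MQF.avgLoss τ (X n ω) (θ₀ n ω)} :=
    fun ℓ₁ h₁ ℓ₂ h₂ => MQF.exists_highProb_le_avgLoss_sub hp₁ hp₂ hT hτ hmodel hc hM2 hfc hX
      (hbdd ℓ₁ (hsub₁ _ h₁) ℓ₂ (hsub₂ _ h₂)) (hle ℓ₁ h₁ ℓ₂ h₂)
  obtain ⟨b₀, hb₀⟩ := hlow k₁ (Finset.mem_Icc.2 ⟨le_rfl, hK₁⟩) k₂ (Finset.mem_Icc.2 ⟨le_rfl, hK₂⟩)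
  have hover : ∀ ℓ₁ ∈ Finset.Icc k₁ K₁, ∀ ℓ₂ ∈ Finset.Icc k₂ K₂, ∃ b : ℝ,
      MQF.HighProb l μ fun n => {ω | |MQF.avgLoss τ (X n ω) (θhat n ℓ₁ ℓ₂ ω) -
        MQF.avgLoss τ (X n ω) (θhat n k₁ k₂ ω)| ≤
          b * (MQF.rate (p₁ n) (p₂ n) (T n) ^ 2)⁻¹} := by
    intro ℓ₁ h₁ ℓ₂ h₂
    obtain ⟨b, hb⟩ := hlow ℓ₁ h₁ ℓ₂ h₂
    -- Relative to the true parameter both losses lie in [-bL⁻², 0], each with its own constant, so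
    -- they differ by at most the larger bound.
    refine ⟨max b b₀, (hb.inter hb₀).mono_ae ?_⟩
    filter_upwards [hle ℓ₁ h₁ ℓ₂ h₂, hlek] with n hn hn'
    filter_upwards [hn, hn'] with ω hω hω' ⟨hb, hb₀⟩
    simp only [Set.mem_ofPred_eq] at hb hb₀ ⊢
    have hr : 0 ≤ (MQF.rate (p₁ n) (p₂ n) (T n) ^ 2)⁻¹ := by positivity
    have m₁ := mul_le_mul_of_nonneg_right (le_max_left b b₀) hr
    have m₂ := mul_le_mul_of_nonneg_right (le_max_right b b₀) hr
    rw [abs_le]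
    constructor <;> linarith
  -- the factors are strong
  have : Nonempty (Fin k₁) := ⟨⟨0, hk₁⟩⟩
  have : Nonempty (Fin k₂) := ⟨⟨0, hk₂⟩⟩
  obtain ⟨j₁, hj₁⟩ := Finite.exists_min σ
  obtain ⟨j₂, hj₂⟩ := Finite.exists_min σ'
  -- With 2s below every limit, moments within s of their limits exceed s.
  obtain ⟨s, hs, hs₁, hs₂⟩ : ∃ s > 0, (∀ j, 2 * s ≤ σ j) ∧ ∀ j, 2 * s ≤ σ' j := by
    refine ⟨min (σ j₁) (σ' j₂) / 2, half_pos (lt_min (hσ _) (hσ' _)), fun j => ?_, fun j => ?_⟩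
    · linarith [min_le_left (σ j₁) (σ' j₂), hj₁ j]
    · linarith [min_le_right (σ j₁) (σ' j₂), hj₂ j]
  have hstrong := (MQF.HighProb.forall_mem_finset (s := Finset.univ)
    fun j _ => hσlim j s hs).inter (MQF.HighProb.forall_mem_finset (s := Finset.univ)
    fun j _ => hσ'lim j s hs)
  have hfar : ∀ ℓ₁ ℓ₂, (ℓ₁ < k₁ ∨ ℓ₂ < k₂) → MQF.HighProb l μ fun n =>
      {ω | (p₁ n : ℝ) * p₂ n * T n * s ≤
        ‖MQF.commonDiff (θhat n ℓ₁ ℓ₂ ω) (θ₀ n ω)‖ ^ 2} := by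
    intro ℓ₁ ℓ₂ hℓ
    refine hstrong.mono_ae ?_
    filter_upwards [hmem, hp₁.eventually_gt_atTop 0, hp₂.eventually_gt_atTop 0,
      hT.eventually_gt_atTop 0] with n hn g₁ g₂ g₃
    filter_upwards [hn] with ω hω ⟨hr, hr'⟩
    have hF : (θ₀ n ω).F = F₀ n ω := by rw [hθ₀]
    refine MQF.le_norm_commonDiff_sq hω _ hℓ g₁ g₂ g₃ (fun j => ?_) fun j => ?_
    · rw [hF]
      linarith [(abs_lt.1 (hr j (Finset.mem_univ j))).1, hs₁ j]
    · rw [hF]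
      linarith [(abs_lt.1 (hr' j (Finset.mem_univ j))).1, hs₂ j]
  have hunder : ∀ ℓ₁ ∈ Finset.Icc 1 K₁, ∀ ℓ₂ ∈ Finset.Icc 1 K₂, (ℓ₁ < k₁ ∨ ℓ₂ < k₂) →
      MQF.HighProb l μ fun n => {ω | c / 8 * s < MQF.avgLoss τ (X n ω) (θhat n ℓ₁ ℓ₂ ω) -
        MQF.avgLoss τ (X n ω) (θhat n k₁ k₂ ω)} := by
    intro ℓ₁ h₁ ℓ₂ h₂ hℓ
    refine (MQF.highProb_lt_avgLoss_sub hp₁ hp₂ hT hτ hmodel hc hM2 hfc hX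
      (hbdd ℓ₁ h₁ ℓ₂ h₂) hs (hfar ℓ₁ ℓ₂ hℓ)).mono_ae ?_
    filter_upwards [hlek] with n hn
    filter_upwards [hn] with ω hω h
    -- The fit with the true numbers of factors has loss at most that of the true parameter, so the
    -- gap only widens.
    exact lt_of_lt_of_le h (by linarith)
  have hcs : 0 < c / 8 * s := by positivity
  refine ⟨⟨c / 8 * s, hcs, hunder⟩, fun ℓ₁ h₁ ℓ₂ h₂ => ?_, ?_⟩
  · obtain ⟨b, hb⟩ := hover ℓ₁ h₁ ℓ₂ h₂
    exact hb.isBigOInProb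
  -- consistency
  choose! b hb using hover
  have hU := MQF.HighProb.forall_mem_finset (l := l) (μ := μ)
    (s := (Finset.Icc 1 K₁ ×ˢ Finset.Icc 1 K₂).filter fun q => q.1 < k₁ ∨ q.2 < k₂)
    (E := fun q n => {ω | c / 8 * s < MQF.avgLoss τ (X n ω) (θhat n q.1 q.2 ω) -
        MQF.avgLoss τ (X n ω) (θhat n k₁ k₂ ω)}) fun q hq => by
      rw [Finset.mem_filter, Finset.mem_product] at hq
      exact hunder q.1 hq.1.1 q.2 hq.1.2 hq.2
  have hO := MQF.HighProb.forall_mem_finset (l := l) (μ := μ)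
    (s := Finset.Icc k₁ K₁ ×ˢ Finset.Icc k₂ K₂)
    (E := fun q n => {ω | |MQF.avgLoss τ (X n ω) (θhat n q.1 q.2 ω) -
        MQF.avgLoss τ (X n ω) (θhat n k₁ k₂ ω)| ≤
          b q.1 q.2 * (MQF.rate (p₁ n) (p₂ n) (T n) ^ 2)⁻¹}) fun q hq => by
      rw [Finset.mem_product] at hq
      exact hb q.1 hq.1 q.2 hq.2
  have hpen0 : ∀ᶠ n in l, ((k₁ : ℝ) + k₂) * pen n < c / 8 * s := by
    have := hpen.const_mul ((k₁ : ℝ) + k₂)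
    rw [mul_zero] at this
    exact (tendsto_order.1 this).2 _ hcs
  -- Finitely many models are compared, so eventually pen · L² exceeds all their constants
  -- simultaneously.
  have hpenb : ∀ᶠ n in l, ∀ q ∈ Finset.Icc k₁ K₁ ×ˢ Finset.Icc k₂ K₂,
      b q.1 q.2 < pen n * MQF.rate (p₁ n) (p₂ n) (T n) ^ 2 :=
    (Finset.eventually_all _).2 fun q _ => hpenL.eventually_gt_atTop _
  refine (hU.inter hO).mono_ae ?_
  filter_upwards [hkhat, hpen0, hpenb, hpenL.eventually_gt_atTop 0, hp₁.eventually_gt_atTop 0,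
    hp₂.eventually_gt_atTop 0, hT.eventually_gt_atTop 0] with n hn hn0 hnb hn1 g₁ g₂ g₃
  filter_upwards [hn] with ω hω ⟨hu, ho⟩
  have hr : 0 < MQF.rate (p₁ n) (p₂ n) (T n) ^ 2 := pow_pos (MQF.rate_pos g₁ g₂ g₃) 2
  -- Positivity of the penalty is not assumed; it follows eventually from pen · L² → ∞.
  refine hω.eq hk₁' hk₂' (pos_of_mul_pos_left hn1 hr.le) hn0 (fun ℓ₁ h₁ ℓ₂ h₂ hℓ => ?_)
    fun ℓ₁ h₁ ℓ₂ h₂ => ?_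
  · exact hu (ℓ₁, ℓ₂) (Finset.mem_filter.2 ⟨Finset.mk_mem_product h₁ h₂, hℓ⟩)
  · have h₃ := (abs_le.1 (ho (ℓ₁, ℓ₂) (Finset.mk_mem_product h₁ h₂))).1
    have h₄ : b ℓ₁ ℓ₂ * (MQF.rate (p₁ n) (p₂ n) (T n) ^ 2)⁻¹ < pen n := by
      rw [← div_eq_mul_inv, div_lt_iff₀ hr]
      exact hnb (ℓ₁, ℓ₂) (Finset.mk_mem_product h₁ h₂)
    linarith
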